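/- There is an absolute constant $C>0$ such that the following holds. Let $n\ge 1$, let $\Omega\subset\mathbb R^n$ be open, and let $V:\mathbb R^n\to\mathbb R$ be bounded and continuous with $V(x)>0$ for all $x\in\Omega$ and $V(x)\ge 0$ for all $x\in\mathbb R^n$. Let $u_0\in H^2(\mathbb R^n)$ and $u_1\in L^2(\mathbb R^n)$ be real-valued, with $\operatorname{supp}u_1\subset\Omega$ (essential support) and $$J_{0,p}^2:=\int_\Omega\frac{|u_1(x)|^2}{V(x)}\,dx<+\infty .$$ Then the Cauchy problem $$u_{tt}+\Delta^2u+V(x)u=0\quad (t>0,\ x\in\mathbb R^n),\qquad u(0,x)=u_0(x),\quad u_t(0,x)=u_1(x)\quad (x\in\mathbb R^n),$$ has a unique weak solution $u\in C([0,\infty);H^2(\mathbb R^n))\cap C^1([0,\infty);L^2(\mathbb R^n))$, and it satisfies $$\|u(t,\cdot)\|^2\le C\,\bigl(\|u_0\|^2+J_{0,p}^2\bigr)\qquad (t\ge 0),$$ where $\|\cdot\|$ is the norm of $L^2(\mathbb R^n)$. Here $u$ in the stated class is a weak solution if it attains the initial data and, for every $\varphi\in H^2(\mathbb R^n)$ and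 every $t>0$, $$\frac{d}{dt}\int_{\mathbb R^n}u_t(t,x)\varphi(x)\,dx+\int_{\mathbb R^n}\Delta u(t,x)\,\Delta\varphi(x)\,dx+\int_{\mathbb R^n}V(x)u(t,x)\varphi(x)\,dx=0 .$$ -/

import Mathlib

open MeasureTheory Set
open scoped ContDiff BoundedContinuousFunction

noncomputable section

namespace PlateEq

/-- Euclidean space `ℝⁿ`. -/
abbrev Space (n : ℕ) : Type := EuclideanSpace ℝ (Fin n)

/-- The real Hilbert space `L²(ℝⁿ)` of real-valued functions, with Lebesgue measure. -/
abbrev L2 (n : ℕ) : Type := Lp ℝ 2 (volume : Measure (Space n))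

/-- `g ∈ L²(ℝⁿ)` is the weak partial derivative `∂f/∂xᵢ` of `f ∈ L²(ℝⁿ)`:
`∫ f ∂ᵢφ = - ∫ g φ` for every `φ ∈ C_c^∞(ℝⁿ)`. -/
def HasWeakPartial {n : ℕ} (i : Fin n) (f g : L2 n) : Prop :=
  ∀ φ : Space n → ℝ, ContDiff ℝ ∞ φ → HasCompactSupport φ →
    ∫ x, f x * fderiv ℝ φ x (EuclideanSpace.single i 1) = - ∫ x, g x * φ x

theorem integrable_mul_of_test {n : ℕ} (f : L2 n) {φ : Space n → ℝ} (hφ : Continuous φ)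
    (hc : HasCompactSupport φ) : Integrable (fun x => f x * φ x) :=
  (Lp.memLp f).integrable_mul (q := 2) (hφ.memLp_of_hasCompactSupport hc)

theorem continuous_partial {n : ℕ} (i : Fin n) {φ : Space n → ℝ} (hφ : ContDiff ℝ ∞ φ) :
    Continuous (fun x => fderiv ℝ φ x (EuclideanSpace.single i 1)) :=
  (hφ.continuous_fderiv (by simp)).clm_apply continuous_const

theorem hasCompactSupport_partial {n : ℕ} (i : Fin n) {φ : Space n → ℝ}
    (hc : HasCompactSupport φ) :
    HasCompactSupport (fun x => fderiv ℝ φ x (EuclideanSpace.single i 1)) :=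
  hc.fderiv_apply ℝ _

theorem integral_add_mul {n : ℕ} (f f' : L2 n) {φ : Space n → ℝ} (hφ : Continuous φ)
    (hc : HasCompactSupport φ) :
    ∫ x, (f + f' : L2 n) x * φ x = (∫ x, f x * φ x) + ∫ x, f' x * φ x := by
  rw [← integral_add (integrable_mul_of_test f hφ hc) (integrable_mul_of_test f' hφ hc)]
  refine integral_congr_ae ?_
  filter_upwards [Lp.coeFn_add f f'] with x hx
  rw [hx, Pi.add_apply, add_mul]

theorem integral_smul_mul {n : ℕ} (c : ℝ) (f : L2 n) (φ : Space n → ℝ) :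
    ∫ x, (c • f : L2 n) x * φ x = c * ∫ x, f x * φ x := by
  rw [← integral_const_mul]
  refine integral_congr_ae ?_
  filter_upwards [Lp.coeFn_smul c f] with x hx
  rw [hx, Pi.smul_apply, smul_eq_mul, mul_assoc]

theorem HasWeakPartial.zero {n : ℕ} (i : Fin n) : HasWeakPartial i (0 : L2 n) 0 := by
  intro φ _ _
  have h : ∀ ψ : Space n → ℝ, ∫ x, (0 : L2 n) x * ψ x = 0 := fun ψ => by
    have h0 := integral_smul_mul 0 (0 : L2 n) ψ
    rwa [zero_smul, zero_mul] at h0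
  rw [h, h, neg_zero]

theorem HasWeakPartial.add {n : ℕ} {i : Fin n} {f g f' g' : L2 n}
    (h : HasWeakPartial i f g) (h' : HasWeakPartial i f' g') :
    HasWeakPartial i (f + f') (g + g') := by
  intro φ hφ hc
  rw [integral_add_mul f f' (continuous_partial i hφ) (hasCompactSupport_partial i hc),
    integral_add_mul g g' hφ.continuous hc, h φ hφ hc, h' φ hφ hc, neg_add]

theorem HasWeakPartial.smul {n : ℕ} {i : Fin n} {f g : L2 n} (c : ℝ)
    (h : HasWeakPartial i f g) : HasWeakPartial i (c • f) (c • g) := by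
  intro φ hφ hc
  rw [integral_smul_mul, integral_smul_mul, h φ hφ hc, mul_neg]

/-- Weak partial derivatives are unique. -/
theorem HasWeakPartial.unique {n : ℕ} {i : Fin n} {f g g' : L2 n}
    (h : HasWeakPartial i f g) (h' : HasWeakPartial i f g') : g = g' := by
  have hloc : ∀ k : L2 n, LocallyIntegrable k (volume : Measure (Space n)) := fun k =>
    (Lp.memLp k).locallyIntegrable (by norm_num)
  refine Lp.ext (ae_eq_of_integral_contDiff_smul_eq (hloc g) (hloc g') ?_)
  intro φ hφ hc
  have := (h φ hφ hc).symm.trans (h' φ hφ hc)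
  simpa [mul_comm] using this

/-- The Sobolev space `H²(ℝⁿ)`: the functions `f ∈ L²(ℝⁿ)` whose weak partial derivatives of
order one and two lie in `L²(ℝⁿ)`. An element is stored with its derivatives, as
`(f, (∂ᵢf)ᵢ, (∂ⱼ∂ᵢf)ᵢⱼ)`; these are determined by `f` (see `H2.toL2_injective`). The topology
is that of the usual `H²` norm: `L²` convergence of `f`, of all `∂ᵢf` and of all `∂ⱼ∂ᵢf`. -/
def H2 (n : ℕ) : Submodule ℝ (L2 n × (Fin n → L2 n) × (Fin n → Fin n → L2 n)) where
  carrier := {p | (∀ i, HasWeakPartial i p.1 (p.2.1 i)) ∧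
    ∀ i j, HasWeakPartial j (p.2.1 i) (p.2.2 i j)}
  zero_mem' := ⟨fun i => HasWeakPartial.zero i, fun _ j => HasWeakPartial.zero j⟩
  add_mem' := fun hp hq =>
    ⟨fun i => (hp.1 i).add (hq.1 i), fun i j => (hp.2 i j).add (hq.2 i j)⟩
  smul_mem' := fun c _ hp => ⟨fun i => (hp.1 i).smul c, fun i j => (hp.2 i j).smul c⟩

/-- The function `f ∈ L²(ℝⁿ)` underlying an element of `H²(ℝⁿ)`. -/
def H2.toL2 {n : ℕ} (f : H2 n) : L2 n := f.1.1

/-- The weak Laplacian `Δf = ∑ᵢ ∂ᵢ∂ᵢf ∈ L²(ℝⁿ)` of `f ∈ H²(ℝⁿ)`. -/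
def H2.laplacian {n : ℕ} (f : H2 n) : L2 n := ∑ i, f.1.2.2 i i

theorem H2.toL2_injective {n : ℕ} : Function.Injective (H2.toL2 (n := n)) := by
  rintro ⟨⟨f, g, h⟩, hp⟩ ⟨⟨f', g', h'⟩, hq⟩ hff
  obtain rfl : f = f' := hff
  obtain rfl : g = g' := funext fun i => (hp.1 i).unique (hq.1 i)
  obtain rfl : h = h' := funext fun i => funext fun j => (hp.2 i j).unique (hq.2 i j)
  rfl

/-- The support of (the class of) `f`: the complement of the largest open set on which `f`
vanishes almost everywhere. -/
def essSupp {n : ℕ} (f : L2 n) : Set (Space n) :=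
  (⋃₀ {U : Set (Space n) | IsOpen U ∧ ∀ᵐ x, x ∈ U → f x = 0})ᶜ

/-- The time derivative `u_t(t) ∈ L²(ℝⁿ)` for `t ∈ [0, ∞)` (one-sided at `t = 0`). -/
def timeDeriv {n : ℕ} (u : ℝ → H2 n) (t : ℝ) : L2 n :=
  derivWithin (fun s => H2.toL2 (u s)) (Ici 0) t

/-- `u ∈ C([0,∞); H²(ℝⁿ)) ∩ C¹([0,∞); L²(ℝⁿ))` is a weak solution of
`u_tt + Δ²u + V u = 0`, `u(0) = u₀`, `u_t(0) = u₁`: for every `φ ∈ H²(ℝⁿ)` and `t > 0`,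
`d/dt (u_t(t), φ) + (Δu(t), Δφ) + ∫ V u(t) φ = 0`. Only the values `u t` for `t ≥ 0` matter. -/
structure IsWeakSolution {n : ℕ} (V : Space n →ᵇ ℝ) (u₀ : H2 n) (u₁ : L2 n)
    (u : ℝ → H2 n) : Prop where
  continuousOn : ContinuousOn u (Ici 0)
  contDiffOn : ContDiffOn ℝ 1 (fun t => H2.toL2 (u t)) (Ici 0)
  init : u 0 = u₀
  init_deriv : timeDeriv u 0 = u₁
  weak : ∀ φ : H2 n, ∀ t : ℝ, 0 < t →
    HasDerivAt (fun s => inner ℝ (timeDeriv u s) (H2.toL2 φ))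
      (-(inner ℝ (H2.laplacian (u t)) (H2.laplacian φ) + ∫ x, V x * H2.toL2 (u t) x * H2.toL2 φ x)) t

end PlateEq

end

/-! ### Differential equations in Banach spaces -/

namespace PlateEq

/-! The bound is an energy identity for the primitive W(t) = ∫₀ᵗ u. Integrating the weak equation
once in time gives (u_t, φ) + (∫₀ᵗ Δu, Δφ) + (V W, φ) = (u₁, φ) (`IsWeakSolution.integrated`). Here
φ = u(t) = W'(t) is admissible, whereas u_t, being only in L², could not be used to test the
original equation. The result is ‖u‖² + ‖∫₀ᵗ Δu‖² + ∫ V W² = ‖u₀‖² + 2 (u₁, W)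
(`IsWeakSolution.energy`). Pointwise, 2 u₁ W ≤ u₁²/V + V W², so the potential term on the left
absorbs the last term (`two_mul_inner_le`), and C = 1 suffices. For the difference of two solutions
the data vanish, and the same identity gives uniqueness.

For existence, write the equation as u_tt + w² u = (1 - V) u with w = (1 + Δ²)^{1/2}, which the
Fourier transform turns into multiplication by a function ≥ 1. With a = w u and b = u_t, the
unknowns e^{itw}(a + ib) and e^{-itw}(a - ib) satisfy an ordinary differential equation with bounded
Lipschitz right-hand side, solved by a weighted contraction (`exists_global_solution`,
`exists_wave`). Every element of H² has the form w⁻¹c with c in L² on the Fourier side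
(`exists_fourier_repr`); this supplies the initial value and turns the weak form into an identity
between bounded multipliers. Since V is real, the real part of the complex solution is the required
one. -/

/-- Product rule for a bounded, strongly differentiable family of operators. -/
theorem hasDerivAt_strong_apply {E F : Type*} [NormedAddCommGroup E] [NormedSpace ℝ E]
    [NormedAddCommGroup F] [NormedSpace ℝ F] {R : ℝ → E →L[ℝ] F} {K : ℝ}
    (hK : ∀ t x, ‖R t x‖ ≤ K * ‖x‖) {y : ℝ → E} {y' : E} {r : F} {t : ℝ}
    (hR : HasDerivAt (fun s => R s (y t)) r t) (hc : ContinuousAt (fun s => R s y') t)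
    (hy : HasDerivAt y y' t) : HasDerivAt (fun s => R s (y s)) (r + R t y') t := by
  -- Split `R s (y s)` into `R s (y t)`, `(s - t) • R s y'` and `R s` of the Taylor remainder. The
  -- uniform bound `K` keeps the last term o(s - t), so no operator-norm continuity of `R` is
  -- needed.
  have h1 : HasDerivAt (fun s => (s - t) • R s y') (R t y') t := by
    rw [hasDerivAt_iff_tendsto_slope]
    refine (hc.tendsto.mono_left nhdsWithin_le_nhds).congr' ?_
    filter_upwards [self_mem_nhdsWithin] with s hs
    have : s - t ≠ 0 := sub_ne_zero.2 hs
    simp [slope_def_module, smul_smul, this]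
  have h2 : HasDerivAt (fun s => R s (y s - y t - (s - t) • y')) 0 t := by
    rw [hasDerivAt_iff_isLittleO]
    have ho := hasDerivAt_iff_isLittleO.1 hy
    refine Asymptotics.IsBigO.trans_isLittleO ?_ ho
    refine Asymptotics.IsBigO.of_bound K (Filter.Eventually.of_forall fun s => ?_)
    simpa using hK s (y s - y t - (s - t) • y')
  convert! (hR.add h1).add h2 using 1
  · ext s
    simp
  · simp

open Real intervalIntegral in
-- The gain 1/L relative to the weight e^{L|t|} is what makes the Picard map a contraction on the
-- whole line.
theorem abs_integral_exp_abs_le {L : ℝ} (hL : 0 < L) (t : ℝ) :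
    |∫ s in (0 : ℝ)..t, exp (L * |s|)| ≤ exp (L * |t|) / L := by
  have hpos : ∀ t, 0 ≤ t → |∫ s in (0 : ℝ)..t, exp (L * |s|)| ≤ exp (L * |t|) / L := by
    intro t ht
    have h1 : ∫ s in (0 : ℝ)..t, exp (L * |s|) = ∫ s in (0 : ℝ)..t, exp (L * s) := by
      refine integral_congr fun s hs => ?_
      rw [uIcc_of_le ht] at hs
      simp only [abs_of_nonneg hs.1]
    have h2 : ∫ s in (0 : ℝ)..t, exp (L * s) = (exp (L * t) - 1) / L := by
      rw [integral_comp_mul_left (fun x => exp x) hL.ne']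
      simp [div_eq_inv_mul]
    rw [h1, h2, abs_of_nonneg ht, abs_of_nonneg
      (div_nonneg (by simpa using mul_nonneg hL.le ht) hL.le)]
    gcongr
    linarith
  rcases le_total 0 t with ht | ht
  · exact hpos t ht
  · have := hpos (-t) (by linarith)
    have h3 : ∫ s in (0 : ℝ)..(-t), exp (L * |s|) = -∫ s in (0 : ℝ)..t, exp (L * |s|) := by
      rw [← integral_symm]
      simpa using (integral_comp_neg (a := 0) (b := -t) (fun s => exp (L * |s|)))
    rwa [h3, abs_neg, abs_neg] at this

/-- Global solvability of `y' = f(t, y)`, `y(0) = y₀`, by the contraction principle for the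
unknown `e^{-L|t|} y(t)`. -/
theorem exists_global_solution {E : Type*} [NormedAddCommGroup E] [NormedSpace ℝ E]
    [CompleteSpace E] {f : ℝ → E → E} {K : ℝ} (hf : Continuous fun p : ℝ × E => f p.1 p.2)
    (hLip : ∀ t x y, ‖f t x - f t y‖ ≤ K * ‖x - y‖) (h0 : ∀ t, f t 0 = 0) (y₀ : E) :
    ∃ y : ℝ → E, y 0 = y₀ ∧ ∀ t, HasDerivAt y (f t (y t)) t := by
  wlog hK : 0 < K generalizing K
  · refine this (K := 1) (fun t x y => (hLip t x y).trans ?_) one_pos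
    exact mul_le_mul_of_nonneg_right (by linarith) (norm_nonneg _)
  -- The contraction constant will be K / L = 1/2.
  set L : ℝ := 2 * K with hL
  have hLpos : 0 < L := by positivity
  set e : ℝ → ℝ := fun t => Real.exp (L * |t|) with he
  have hec : Continuous e := by fun_prop
  have hepos : ∀ t, 0 < e t := fun t => Real.exp_pos _
  have he1 : ∀ t, 1 ≤ e t := fun t => Real.one_le_exp (by positivity)
  have hint : ∀ z : ℝ →ᵇ E, Continuous fun s => f s (e s • z s) := fun z =>
    hf.comp (continuous_id.prodMk (hec.smul z.continuous))
  have hprim : ∀ z : ℝ →ᵇ E, ∀ t, HasDerivAt (fun t => ∫ s in (0 : ℝ)..t, f s (e s • z s))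
      (f t (e t • z t)) t := fun z t => ((hint z).integral_hasStrictDerivAt 0 t).hasDerivAt
  have hdiff : ∀ z z' : ℝ →ᵇ E, ∀ t, (e t)⁻¹ * ‖(∫ s in (0 : ℝ)..t, f s (e s • z s))
      - ∫ s in (0 : ℝ)..t, f s (e s • z' s)‖ ≤ 1 / 2 * ‖z - z'‖ := by
    intro z z' t
    rw [← intervalIntegral.integral_sub ((hint z).intervalIntegrable _ _)
      ((hint z').intervalIntegrable _ _)]
    have hb : ∀ s, ‖f s (e s • z s) - f s (e s • z' s)‖ ≤ K * ‖z - z'‖ * e s := fun s => by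
      refine (hLip s _ _).trans ?_
      rw [← smul_sub, norm_smul, Real.norm_of_nonneg (hepos s).le]
      have := (z - z').norm_coe_le_norm s
      rw [BoundedContinuousFunction.coe_sub, Pi.sub_apply] at this
      calc K * (e s * ‖z s - z' s‖) ≤ K * (e s * ‖z - z'‖) := by
            gcongr
        _ = _ := by ring
    have h1 : ‖∫ s in (0 : ℝ)..t, (f s (e s • z s) - f s (e s • z' s))‖
        ≤ |∫ s in (0 : ℝ)..t, K * ‖z - z'‖ * e s| :=
      intervalIntegral.norm_integral_le_abs_of_norm_le
        (Filter.Eventually.of_forall fun s => hb s)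
        ((continuous_const.mul hec).intervalIntegrable _ _)
    rw [intervalIntegral.integral_const_mul, abs_mul,
      abs_of_nonneg (by positivity : 0 ≤ K * ‖z - z'‖)] at h1
    have h2 := h1.trans (mul_le_mul_of_nonneg_left (abs_integral_exp_abs_le hLpos t)
      (by positivity))
    rw [inv_mul_le_iff₀ (hepos t)]
    refine h2.trans (le_of_eq ?_)
    have hKL : K = L / 2 := by rw [hL]; ring
    rw [hKL]
    field_simp
    simp only [he, mul_comm]
  have hzero : ∀ t, ∫ s in (0 : ℝ)..t, f s (e s • (0 : ℝ →ᵇ E) s) = 0 := fun t => by simp [h0]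
  let T : (ℝ →ᵇ E) → (ℝ →ᵇ E) := fun z =>
    BoundedContinuousFunction.ofNormedAddCommGroup
      (fun t => (e t)⁻¹ • (y₀ + ∫ s in (0 : ℝ)..t, f s (e s • z s)))
      ((hec.inv₀ fun t => (hepos t).ne').smul (continuous_const.add
        (continuous_iff_continuousAt.2 fun t => (hprim z t).continuousAt)))
      (‖y₀‖ + 1 / 2 * ‖z‖) (fun t => by
        -- Comparison with the zero function, where the integral vanishes, shows that the image is
        -- bounded.
        have h := hdiff z 0 t
        rw [hzero, sub_zero, sub_zero] at h
        rw [norm_smul, norm_inv, Real.norm_of_nonneg (hepos t).le]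
        refine (mul_le_mul_of_nonneg_left (norm_add_le _ _) (inv_nonneg.2 (hepos t).le)).trans ?_
        rw [mul_add]
        refine add_le_add ?_ h
        exact mul_le_of_le_one_left (norm_nonneg _) (inv_le_one_of_one_le₀ (he1 t)))
  have hT : ContractingWith (1 / 2) T := by
    refine ⟨by rw [← NNReal.coe_lt_coe]; norm_num, LipschitzWith.of_dist_le_mul fun z z' => ?_⟩
    rw [dist_eq_norm, dist_eq_norm]
    refine (BoundedContinuousFunction.norm_le (by positivity)).2 fun t => ?_
    have h := hdiff z z' t
    simp only [BoundedContinuousFunction.coe_sub, Pi.sub_apply, T,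
      BoundedContinuousFunction.coe_ofNormedAddCommGroup]
    rw [← smul_sub, add_sub_add_left_eq_sub, norm_smul, norm_inv,
      Real.norm_of_nonneg (hepos t).le]
    simpa using h
  set z := hT.fixedPoint T
  have hz : T z = z := hT.fixedPoint_isFixedPt
  have hez : ∀ t, e t • z t = y₀ + ∫ s in (0 : ℝ)..t, f s (e s • z s) := fun t => by
    conv_lhs => rw [← hz]
    simp only [T, BoundedContinuousFunction.coe_ofNormedAddCommGroup]
    rw [smul_smul, mul_inv_cancel₀ (hepos t).ne', one_smul]
  refine ⟨fun t => e t • z t, (hez 0).trans (by rw [intervalIntegral.integral_same, add_zero]),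
    fun t => ?_⟩
  exact ((hprim z t).const_add y₀).congr_of_eventuallyEq (Filter.Eventually.of_forall hez)

end PlateEq

/-! ### Multiplication operators on L² -/

namespace PlateEq

section Multiplication

variable {X : Type*} [TopologicalSpace X] [MeasurableSpace X] [BorelSpace X]
  {μ : Measure X} {𝕜 : Type*} [RCLike 𝕜]

theorem memLp_boundedContinuous_mul (f : X →ᵇ 𝕜) (g : Lp 𝕜 2 μ) :
    MemLp (fun x => f x * g x) 2 μ := by
  refine MemLp.of_le_mul (c := ‖f‖) (Lp.memLp g)
    (f.continuous.measurable.aestronglyMeasurable.mul (Lp.aestronglyMeasurable g)) ?_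
  refine Filter.Eventually.of_forall fun x => ?_
  rw [norm_mul]
  exact mul_le_mul_of_nonneg_right (f.norm_coe_le_norm x) (norm_nonneg _)

/-- Multiplication by a bounded continuous function, as a bounded operator on `L²`. -/
noncomputable def mulL (μ : Measure X) (f : X →ᵇ 𝕜) : Lp 𝕜 2 μ →L[𝕜] Lp 𝕜 2 μ :=
  LinearMap.mkContinuous
    { toFun := fun g => (memLp_boundedContinuous_mul f g).toLp
      map_add' := fun g h => by
        rw [← MemLp.toLp_add]
        refine MemLp.toLp_congr _ _ ?_
        filter_upwards [Lp.coeFn_add g h] with x hx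
        simp only [hx, Pi.add_apply, mul_add]
      map_smul' := fun c g => by
        rw [RingHom.id_apply, ← MemLp.toLp_const_smul]
        refine MemLp.toLp_congr _ _ ?_
        filter_upwards [Lp.coeFn_smul c g] with x hx
        simp only [hx, Pi.smul_apply, smul_eq_mul]
        ring }
    ‖f‖ fun g => by
      refine Lp.norm_le_mul_norm_of_ae_le_mul ?_
      filter_upwards [(memLp_boundedContinuous_mul f g).coeFn_toLp] with x hx
      simp only [LinearMap.coe_mk, AddHom.coe_mk]
      rw [hx, norm_mul]
      exact mul_le_mul_of_nonneg_right (f.norm_coe_le_norm x) (norm_nonneg _)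

theorem coeFn_mulL (f : X →ᵇ 𝕜) (g : Lp 𝕜 2 μ) : mulL μ f g =ᵐ[μ] fun x => f x * g x :=
  (memLp_boundedContinuous_mul f g).coeFn_toLp

theorem norm_mulL_apply_le (f : X →ᵇ 𝕜) (g : Lp 𝕜 2 μ) : ‖mulL μ f g‖ ≤ ‖f‖ * ‖g‖ :=
  LinearMap.mkContinuous_norm_le _ (norm_nonneg f) _ |> fun h =>
    (ContinuousLinearMap.le_opNorm _ _).trans (mul_le_mul_of_nonneg_right h (norm_nonneg _))

theorem mulL_mulL (f g : X →ᵇ 𝕜) (h : Lp 𝕜 2 μ) : mulL μ f (mulL μ g h) = mulL μ (f * g) h := by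
  refine Lp.ext ?_
  filter_upwards [coeFn_mulL f (mulL μ g h), coeFn_mulL g h, coeFn_mulL (f * g) h] with x h1 h2 h3
  rw [h1, h2, h3, BoundedContinuousFunction.coe_mul, Pi.mul_apply, mul_assoc]

theorem inner_mulL_real (f : X →ᵇ ℝ) (g h : Lp ℝ 2 μ) :
    inner ℝ (mulL μ f g) h = ∫ x, f x * g x * h x ∂μ := by
  rw [L2.inner_def]
  refine integral_congr_ae ?_
  filter_upwards [coeFn_mulL f g] with x hx
  rw [hx]
  simp [mul_comm]

theorem inner_mulL_real_comm (f : X →ᵇ ℝ) (g h : Lp ℝ 2 μ) :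
    inner ℝ (mulL μ f g) h = inner ℝ (mulL μ f h) g := by
  rw [inner_mulL_real, inner_mulL_real]
  congr 1 with x
  ring

theorem inner_mulL_left (f : X →ᵇ 𝕜) (g h : Lp 𝕜 2 μ) :
    inner 𝕜 (mulL μ f g) h = inner 𝕜 g (mulL μ (star f) h) := by
  rw [L2.inner_def, L2.inner_def]
  refine integral_congr_ae ?_
  filter_upwards [coeFn_mulL f g, coeFn_mulL (star f) h] with x h1 h2
  rw [h1, h2]
  simp only [RCLike.inner_apply, BoundedContinuousFunction.star_apply, map_mul]
  rw [RCLike.star_def]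
  ring

end Multiplication

end PlateEq

/-! ### The unitary group e^{itw} and its smoothing by 1/w -/

namespace PlateEq

open Filter Topology

section Symbols

variable {X : Type*} [TopologicalSpace X]

variable (w : C(X, ℝ))

/-- The bounded function `e^{itw}`. -/
noncomputable def phase (t : ℝ) : X →ᵇ ℂ :=
  BoundedContinuousFunction.ofNormedAddCommGroup (fun x => Complex.exp ((t * w x : ℝ) * Complex.I))
    (by fun_prop) 1 fun x => (Complex.norm_exp_ofReal_mul_I _).le

variable {w} in
/-- The bounded function `1/w`, for `w ≥ 1`. -/
noncomputable def recip (hw : ∀ x, 1 ≤ w x) : X →ᵇ ℂ :=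
  BoundedContinuousFunction.ofNormedAddCommGroup (fun x => ((w x)⁻¹ : ℝ))
    (Complex.continuous_ofReal.comp
      (w.continuous.inv₀ fun x => (one_pos.trans_le (hw x)).ne')) 1 fun x => by
    rw [Complex.norm_real, norm_inv, Real.norm_of_nonneg (zero_le_one.trans (hw x))]
    exact inv_le_one_of_one_le₀ (hw x)

variable {w}

theorem phase_apply (t : ℝ) (x : X) :
    phase w t x = Complex.exp ((t * w x : ℝ) * Complex.I) := rfl

theorem recip_apply (hw : ∀ x, 1 ≤ w x) (x : X) : recip hw x = ((w x)⁻¹ : ℝ) := rfl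

theorem norm_phase_apply (t : ℝ) (x : X) : ‖phase w t x‖ = 1 :=
  Complex.norm_exp_ofReal_mul_I _

theorem norm_phase_le (t : ℝ) : ‖phase w t‖ ≤ 1 :=
  (BoundedContinuousFunction.norm_le zero_le_one).2 fun x => (norm_phase_apply t x).le

theorem norm_recip_le (hw : ∀ x, 1 ≤ w x) : ‖recip hw‖ ≤ 1 :=
  BoundedContinuousFunction.norm_ofNormedAddCommGroup_le _ zero_le_one _

theorem phase_mul_phase_neg (t : ℝ) : phase w t * phase w (-t) = 1 := by
  ext x
  rw [BoundedContinuousFunction.coe_mul, Pi.mul_apply, phase_apply, phase_apply, ← Complex.exp_add]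
  simp

theorem phase_zero : phase w 0 = 1 := by
  ext x
  simp [phase_apply]

theorem norm_phase_sub_le (s t : ℝ) (x : X) : ‖phase w s x - phase w t x‖ ≤ |s - t| * |w x| := by
  have h : phase w s x - phase w t x
      = phase w t x * (Complex.exp (Complex.I * ((s - t) * w x : ℝ)) - 1) := by
    simp only [phase_apply, mul_sub, ← Complex.exp_add, mul_one]
    congr 2
    push_cast
    ring
  rw [h, norm_mul, norm_phase_apply, one_mul, ← abs_mul]
  exact Real.norm_exp_I_mul_ofReal_sub_one_le

end Symbols

section Propagator

variable {X : Type*} [TopologicalSpace X] [MeasurableSpace X] [BorelSpace X] {μ : Measure X}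

theorem mulL_sub (f g : X →ᵇ ℂ) (ψ : Lp ℂ 2 μ) :
    mulL μ (f - g) ψ = mulL μ f ψ - mulL μ g ψ := by
  refine Lp.ext ?_
  filter_upwards [coeFn_mulL (f - g) ψ, coeFn_mulL f ψ, coeFn_mulL g ψ,
    Lp.coeFn_sub (mulL μ f ψ) (mulL μ g ψ)] with x h1 h2 h3 h4
  rw [h1, h4, Pi.sub_apply, h2, h3, BoundedContinuousFunction.coe_sub, Pi.sub_apply, sub_mul]

theorem mulL_smul (c : ℂ) (f : X →ᵇ ℂ) (ψ : Lp ℂ 2 μ) :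
    mulL μ (c • f) ψ = c • mulL μ f ψ := by
  refine Lp.ext ?_
  filter_upwards [coeFn_mulL (c • f) ψ, coeFn_mulL f ψ, Lp.coeFn_smul c (mulL μ f ψ)]
    with x h1 h2 h3
  rw [h1, h3, Pi.smul_apply, h2, BoundedContinuousFunction.smul_apply, smul_eq_mul, smul_eq_mul,
    mul_assoc]

theorem mulL_one (ψ : Lp ℂ 2 μ) : mulL μ 1 ψ = ψ := by
  refine Lp.ext ?_
  filter_upwards [coeFn_mulL 1 ψ] with x h1
  rw [h1, BoundedContinuousFunction.coe_one, Pi.one_apply, one_mul]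

theorem norm_sq_mulL (f : X →ᵇ ℂ) (ψ : Lp ℂ 2 μ) :
    ‖mulL μ f ψ‖ ^ 2 = ∫ x, ‖f x‖ ^ 2 * ‖ψ x‖ ^ 2 ∂μ := by
  have h := L2.inner_def (𝕜 := ℝ) (mulL μ f ψ) (mulL μ f ψ)
  rw [real_inner_self_eq_norm_sq] at h
  rw [h]
  refine integral_congr_ae ?_
  filter_upwards [coeFn_mulL f ψ] with x hx
  rw [real_inner_self_eq_norm_sq, hx, norm_mul, mul_pow]

/-- Dominated convergence: uniformly bounded symbols converging only pointwise still give strong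
convergence of the operators. Both continuity and differentiability of the group come from this. -/
theorem tendsto_mulL {ι : Type*} {l : Filter ι} [l.IsCountablyGenerated] {m : ι → X →ᵇ ℂ}
    {m₀ : X →ᵇ ℂ} {C : ℝ} (hC : ∀ s x, ‖m s x‖ ≤ C)
    (hm : ∀ x, Tendsto (fun s => m s x) l (𝓝 (m₀ x))) (ψ : Lp ℂ 2 μ) :
    Tendsto (fun s => mulL μ (m s) ψ) l (𝓝 (mulL μ m₀ ψ)) := by
  have hψ : Integrable (fun x => ‖ψ x‖ ^ 2) μ := (Lp.memLp ψ).integrable_norm_pow two_ne_zero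
  have key : Tendsto (fun s => ∫ x, ‖(m s - m₀) x‖ ^ 2 * ‖ψ x‖ ^ 2 ∂μ) l
      (𝓝 (∫ _, (0 : ℝ) ∂μ)) := by
    refine tendsto_integral_filter_of_dominated_convergence
      (fun x => (C + ‖m₀‖) ^ 2 * ‖ψ x‖ ^ 2) ?_ ?_ (hψ.const_mul _) ?_
    · refine Eventually.of_forall fun s => ?_
      exact ((m s - m₀).continuous.norm.pow 2).measurable.aestronglyMeasurable.mul
        hψ.aestronglyMeasurable
    · refine Eventually.of_forall fun s => Eventually.of_forall fun x => ?_
      rw [Real.norm_of_nonneg (by positivity)]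
      gcongr
      exact (norm_sub_le _ _).trans (add_le_add (hC s x) (m₀.norm_coe_le_norm x))
    · refine Eventually.of_forall fun x => ?_
      have h := (((hm x).sub_const (m₀ x)).norm.pow 2).mul_const (‖ψ x‖ ^ 2)
      simpa using h
  rw [integral_zero] at key
  rw [tendsto_iff_norm_sub_tendsto_zero]
  have h2 := (Real.continuous_sqrt.tendsto _).comp key
  rw [Real.sqrt_zero] at h2
  refine h2.congr fun s => ?_
  rw [Function.comp_apply, ← norm_sq_mulL, Real.sqrt_sq (norm_nonneg _), mulL_sub]

variable {w : C(X, ℝ)}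

theorem norm_mulL_phase_le (t : ℝ) (ψ : Lp ℂ 2 μ) : ‖mulL μ (phase w t) ψ‖ ≤ ‖ψ‖ :=
  (norm_mulL_apply_le _ _).trans (mul_le_of_le_one_left (norm_nonneg _) (norm_phase_le t))

theorem norm_mulL_recip_le (hw : ∀ x, 1 ≤ w x) (ψ : Lp ℂ 2 μ) : ‖mulL μ (recip hw) ψ‖ ≤ ‖ψ‖ :=
  (norm_mulL_apply_le _ _).trans (mul_le_of_le_one_left (norm_nonneg _) (norm_recip_le hw))

theorem continuous_mulL_phase (ψ : Lp ℂ 2 μ) : Continuous fun t => mulL μ (phase w t) ψ := by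
  refine continuous_iff_continuousAt.2 fun t => ?_
  refine tendsto_mulL (C := 1) (fun s x => (norm_phase_apply s x).le) (fun x => ?_) ψ
  have : Continuous fun s => phase w s x := by
    simp only [phase_apply]
    fun_prop
  exact this.tendsto t

theorem continuous_mulL_phase_prod :
    Continuous fun p : ℝ × Lp ℂ 2 μ => mulL μ (phase w p.1) p.2 := by
  refine continuous_prod_of_continuous_lipschitzWith' _ 1 (fun t => ?_) continuous_mulL_phase
  refine LipschitzWith.of_dist_le_mul fun x y => ?_
  simp only [dist_eq_norm, ← map_sub]
  simpa using norm_mulL_phase_le (w := w) t (x - y)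

/-- Strong differentiability of the smoothed propagator `e^{itw}/w`. -/
theorem hasDerivAt_recip_phase (hw : ∀ x, 1 ≤ w x) (ψ : Lp ℂ 2 μ) (t : ℝ) :
    HasDerivAt (fun s => mulL μ (recip hw) (mulL μ (phase w s) ψ))
      (Complex.I • mulL μ (phase w t) ψ) t := by
  rw [hasDerivAt_iff_tendsto_slope]
  have hpos : ∀ x, 0 < w x := fun x => one_pos.trans_le (hw x)
  have h1 : ∀ s, slope (fun s => mulL μ (recip hw) (mulL μ (phase w s) ψ)) t s
      = mulL μ (((s - t)⁻¹ : ℂ) • (recip hw * phase w s - recip hw * phase w t)) ψ := by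
    intro s
    rw [slope_def_module, mulL_smul, mulL_sub, mulL_mulL, mulL_mulL, ← Complex.ofReal_sub,
      ← Complex.ofReal_inv]
    rfl
  rw [← mulL_smul]
  refine Tendsto.congr (fun s => (h1 s).symm) ?_
  -- The factor 1/w compensates the growth of |e^{isw} - e^{itw}| ≤ |s - t| |w|, so the difference
  -- quotients are bounded by 1. At s = t the quotient is 0 and the bound persists.
  refine tendsto_mulL (C := 1) (fun s x => ?_) (fun x => ?_) ψ
  · have : ((((s - t)⁻¹ : ℂ) • (recip hw * phase w s - recip hw * phase w t)) : X →ᵇ ℂ) x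
        = ((s - t)⁻¹ : ℝ) * (((w x)⁻¹ : ℝ) * (phase w s x - phase w t x)) := by
      simp only [BoundedContinuousFunction.coe_smul, BoundedContinuousFunction.coe_sub,
        BoundedContinuousFunction.coe_mul, Pi.sub_apply, Pi.mul_apply, recip_apply, smul_eq_mul]
      push_cast
      ring
    rw [this, norm_mul, norm_mul, Complex.norm_real, Complex.norm_real, norm_inv, norm_inv,
      Real.norm_eq_abs, Real.norm_eq_abs]
    calc |s - t|⁻¹ * (|w x|⁻¹ * ‖phase w s x - phase w t x‖)
        ≤ |s - t|⁻¹ * (|w x|⁻¹ * (|s - t| * |w x|)) := by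
          gcongr
          exact norm_phase_sub_le s t x
      _ = (|s - t|⁻¹ * |s - t|) * (|w x|⁻¹ * |w x|) := by ring
      _ ≤ 1 * 1 := by
          gcongr
          · exact inv_mul_le_one
          · exact inv_mul_le_one
      _ = 1 := one_mul 1
  · have hd : HasDerivAt (fun s : ℝ => (((w x)⁻¹ : ℝ) : ℂ) * phase w s x)
        (Complex.I * phase w t x) t := by
      have h2 : HasDerivAt (fun s : ℝ => ((s * w x : ℝ) : ℂ) * Complex.I) (w x * Complex.I) t := by
        have := ((hasDerivAt_id t).mul_const (w x)).ofReal_comp.mul_const Complex.I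
        simpa using this
      convert! h2.cexp.const_mul (((w x)⁻¹ : ℝ) : ℂ) using 1
      rw [phase_apply]
      have : (w x : ℂ) ≠ 0 := by exact_mod_cast (hpos x).ne'
      push_cast
      field_simp
    have h3 := hasDerivAt_iff_tendsto_slope.1 hd
    refine h3.congr fun s => ?_
    rw [slope_def_module]
    simp only [BoundedContinuousFunction.coe_smul, BoundedContinuousFunction.coe_sub,
        BoundedContinuousFunction.coe_mul, Pi.sub_apply, Pi.mul_apply, recip_apply, smul_eq_mul]
    rw [Complex.real_smul]
    push_cast
    rfl

theorem hasDerivAt_recip_phase_neg (hw : ∀ x, 1 ≤ w x) (ψ : Lp ℂ 2 μ) (t : ℝ) :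
    HasDerivAt (fun s => mulL μ (recip hw) (mulL μ (phase w (-s)) ψ))
      (-(Complex.I • mulL μ (phase w (-t)) ψ)) t := by
  have := (hasDerivAt_recip_phase hw ψ (-t)).scomp t (hasDerivAt_neg t)
  simpa [Function.comp_def] using this

end Propagator

end PlateEq

/-! ### The abstract wave equation u'' + w² u = B u -/

namespace PlateEq

section Wave

/-- Solvability of `u'' + w² u = B u` for a bounded operator `B`, in the unknowns `a = w u` and
`b = u'`, in terms of the group `U(t) = e^{itw}` and of `M = w⁻¹`. -/
theorem exists_wave_abstract {Z : Type*} [NormedAddCommGroup Z] [NormedSpace ℂ Z] [NormedSpace ℝ Z]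
    [IsScalarTower ℝ ℂ Z] [CompleteSpace Z] (M : Z →L[ℂ] Z) (U : ℝ → Z →L[ℂ] Z)
    (hM : ∀ x, ‖M x‖ ≤ ‖x‖) (hUn : ∀ t x, ‖U t x‖ ≤ ‖x‖)
    (hUc : Continuous fun p : ℝ × Z => U p.1 p.2) (hUU : ∀ t x, U t (U (-t) x) = x)
    (hU0 : ∀ x, U 0 x = x)
    (hUd : ∀ x t, HasDerivAt (fun s => M (U s x)) (Complex.I • U t x) t)
    (hUd' : ∀ x t, HasDerivAt (fun s => M (U (-s) x)) (-(Complex.I • U (-t) x)) t)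
    (B : Z →L[ℂ] Z) (a₀ b₀ : Z) :
    ∃ a b : ℝ → Z, Continuous a ∧ Continuous b ∧ a 0 = a₀ ∧ b 0 = b₀ ∧
      (∀ t, HasDerivAt (fun s => M (a s)) (b t) t) ∧
      ∀ t, HasDerivAt (fun s => M (b s)) (-a t + M (B (M (a t)))) t := by
  have hUU' : ∀ t x, U (-t) (U t x) = x := fun t x => by simpa using hUU (-t) x
  -- In the unknowns y = (U(t)(a + ib), U(-t)(a - ib)) the inner expression is a, so `g` is the
  -- forcing B u with u = M a.
  let g : ℝ → Z × Z → Z := fun t y =>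
    B (M ((1 / 2 : ℂ) • (U (-t) y.1 + U t y.2)))
  have hgc : Continuous fun p : ℝ × (Z × Z) => g p.1 p.2 := by
    refine B.continuous.comp (M.continuous.comp ((Continuous.add ?_ ?_).const_smul (1 / 2 : ℂ)))
    · exact hUc.comp (f := fun p : ℝ × (Z × Z) => (-p.1, p.2.1)) (by fun_prop)
    · exact hUc.comp (f := fun p : ℝ × (Z × Z) => (p.1, p.2.2)) (by fun_prop)
  have hgs : ∀ t x y, g t x - g t y = g t (x - y) := fun t x y => by
    simp only [g, ← map_sub, ← smul_sub, Prod.fst_sub, Prod.snd_sub]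
    congr 3
    simp only [map_sub]
    abel
  have hgn : ∀ t y, ‖g t y‖ ≤ ‖B‖ * ‖y‖ := fun t y => by
    refine (B.le_opNorm _).trans (mul_le_mul_of_nonneg_left ?_ (norm_nonneg _))
    refine (hM _).trans ?_
    rw [norm_smul]
    have h1 := norm_add_le (U (-t) y.1) (U t y.2)
    have h2 := (hUn (-t) y.1).trans (norm_fst_le y)
    have h3 := (hUn t y.2).trans (norm_snd_le y)
    norm_num
    linarith
  -- Conjugation by the group has cancelled the unbounded w; only the bounded forcing remains.
  let f : ℝ → Z × Z → Z × Z := fun t y =>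
    (U t (Complex.I • g t y), U (-t) (-(Complex.I • g t y)))
  have hfc : Continuous fun p : ℝ × (Z × Z) => f p.1 p.2 := by
    refine Continuous.prodMk ?_ ?_
    · exact hUc.comp (continuous_fst.prodMk (hgc.const_smul Complex.I))
    · exact hUc.comp (continuous_fst.neg.prodMk (hgc.const_smul Complex.I).neg)
  have hfL : ∀ t x y, ‖f t x - f t y‖ ≤ ‖B‖ * ‖x - y‖ := fun t x y => by
    refine norm_prod_le_iff.2 ⟨?_, ?_⟩
    · simp only [f, Prod.fst_sub, ← map_sub, ← smul_sub, hgs]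
      refine (hUn _ _).trans ?_
      simpa [norm_smul] using hgn t (x - y)
    · simp only [f, Prod.snd_sub, ← map_sub, ← neg_sub', ← smul_sub, hgs]
      refine (hUn _ _).trans ?_
      simpa [norm_smul] using hgn t (x - y)
  have hf0 : ∀ t, f t 0 = 0 := fun t => by
    simp [f, g]
  obtain ⟨y, hy0, hy⟩ := exists_global_solution hfc hfL hf0
    (a₀ + Complex.I • b₀, a₀ - Complex.I • b₀)
  have hyc : Continuous y := continuous_iff_continuousAt.2 fun t => (hy t).continuousAt
  have hy1 : ∀ t, HasDerivAt (fun s => (y s).1) (f t (y t)).1 t := fun t =>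
    (ContinuousLinearMap.fst ℝ (Z) (Z)).hasFDerivAt.comp_hasDerivAt t (hy t)
  have hy2 : ∀ t, HasDerivAt (fun s => (y s).2) (f t (y t)).2 t := fun t =>
    (ContinuousLinearMap.snd ℝ (Z) (Z)).hasFDerivAt.comp_hasDerivAt t (hy t)
  set p : ℝ → Z := fun t => U (-t) (y t).1 with hp
  set q : ℝ → Z := fun t => U t (y t).2 with hq
  have hpc : Continuous p := hUc.comp (continuous_neg.prodMk (continuous_fst.comp hyc))
  have hqc : Continuous q := hUc.comp (continuous_id.prodMk (continuous_snd.comp hyc))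
  have hMU : ∀ t x, ‖M (U t x)‖ ≤ 1 * ‖x‖ := fun t x => by
    rw [one_mul]
    exact (hM _).trans (hUn t x)
  -- Formally p = a + ib solves p' = -iwp + ig, but wp need not lie in the space, so the equation is
  -- stated after applying M.
  have hpd : ∀ t, HasDerivAt (fun s => M (p s))
      (-(Complex.I • p t) + Complex.I • M (g t (y t))) t := fun t => by
    have := hasDerivAt_strong_apply (R := fun s => (M.comp (U (-s))).restrictScalars ℝ) (K := 1)
      (fun s x => hMU (-s) x) (hUd' (y t).1 t)
      ((M.continuous.comp (hUc.comp
        (continuous_neg.prodMk continuous_const))).continuousAt) (hy1 t)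
    convert! this using 2
    change _ = M (U (-t) (U t _))
    rw [hUU', map_smul]
  have hqd : ∀ t, HasDerivAt (fun s => M (q s))
      (Complex.I • q t - Complex.I • M (g t (y t))) t := fun t => by
    have := hasDerivAt_strong_apply (R := fun s => (M.comp (U s)).restrictScalars ℝ) (K := 1)
      (fun s x => hMU s x) (hUd (y t).2 t)
      ((M.continuous.comp (hUc.comp
        (continuous_id.prodMk continuous_const))).continuousAt) (hy2 t)
    rw [sub_eq_add_neg]
    convert! this using 2
    change _ = M (U t (U (-t) _))
    rw [hUU, map_neg, map_smul]
  have hI : Complex.I * Complex.I = -1 := Complex.I_mul_I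
  refine ⟨fun t => (1 / 2 : ℂ) • (p t + q t), fun t => (-Complex.I / 2) • (p t - q t),
    (hpc.add hqc).const_smul _, (hpc.sub hqc).const_smul _, ?_, ?_, fun t => ?_, fun t => ?_⟩
  · simp only [hp, hq, neg_zero, hU0, hy0]
    module
  · simp only [hp, hq, neg_zero, hU0, hy0]
    rw [add_sub_sub_cancel, ← two_smul ℂ, smul_smul, smul_smul]
    have : -Complex.I / 2 * 2 * Complex.I = 1 := by linear_combination -hI
    rw [this, one_smul]
  · have := ((hpd t).add (hqd t)).const_smul (1 / 2 : ℂ)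
    convert! this using 1
    · ext1 s
      simp
    · module
  · have := ((hpd t).sub (hqd t)).const_smul (-Complex.I / 2 : ℂ)
    convert! this using 1
    · ext1 s
      simp
    · change -((1 / 2 : ℂ) • (p t + q t)) + M (g t (y t)) = _
      have h1 : (-Complex.I / 2) • (-(Complex.I • p t) + Complex.I • M (g t (y t))
          - (Complex.I • q t - Complex.I • M (g t (y t))))
          = (Complex.I * Complex.I) • ((1 / 2 : ℂ) • (p t + q t) - M (g t (y t))) := by
        module
      rw [h1, hI]
      module

variable {X : Type*} [TopologicalSpace X] [MeasurableSpace X] [BorelSpace X] {μ : Measure X}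
  {w : C(X, ℝ)}

theorem exists_wave (hw : ∀ x, 1 ≤ w x) (B : Lp ℂ 2 μ →L[ℂ] Lp ℂ 2 μ) (a₀ b₀ : Lp ℂ 2 μ) :
    ∃ a b : ℝ → Lp ℂ 2 μ, Continuous a ∧ Continuous b ∧ a 0 = a₀ ∧ b 0 = b₀ ∧
      (∀ t, HasDerivAt (fun s => mulL μ (recip hw) (a s)) (b t) t) ∧
      ∀ t, HasDerivAt (fun s => mulL μ (recip hw) (b s))
        (-a t + mulL μ (recip hw) (B (mulL μ (recip hw) (a t)))) t :=
  exists_wave_abstract (mulL μ (recip hw)) (fun t => mulL μ (phase w t)) (norm_mulL_recip_le hw)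
    norm_mulL_phase_le continuous_mulL_phase_prod
    (fun t x => by rw [mulL_mulL, phase_mul_phase_neg, mulL_one])
    (fun x => by rw [phase_zero, mulL_one]) (hasDerivAt_recip_phase hw)
    (hasDerivAt_recip_phase_neg hw) B a₀ b₀

end Wave

end PlateEq

/-! ### Weak derivatives on the Fourier side -/

namespace PlateEq

open Filter Topology
open scoped SchwartzMap FourierTransform LineDeriv

variable {n : ℕ}

section Truncation

theorem exists_cutoff (n : ℕ) : ∃ χ : Space n → ℝ, ContDiff ℝ ∞ χ ∧ HasCompactSupport χ ∧
    χ 0 = 1 ∧ ∀ x, |χ x| ≤ 1 := by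
  let b : ContDiffBump (0 : Space n) := ⟨1, 2, one_pos, one_lt_two⟩
  refine ⟨b, b.contDiff, b.hasCompactSupport, b.one_of_mem_closedBall (by simp [b]), fun x => ?_⟩
  rw [abs_of_nonneg b.nonneg]
  exact b.le_one

/-- Weak partial derivatives may be tested against smooth functions in `L²` with a partial
derivative in `L²`. -/
theorem HasWeakPartial.integral_eq {i : Fin n} {f g : L2 n} (h : HasWeakPartial i f g)
    {ψ : Space n → ℝ} (hψ : ContDiff ℝ ∞ ψ) (h2 : MemLp ψ 2)
    (hd2 : MemLp (fun x => fderiv ℝ ψ x (EuclideanSpace.single i 1)) 2) :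
    ∫ x, f x * fderiv ℝ ψ x (EuclideanSpace.single i 1) = - ∫ x, g x * ψ x := by
  obtain ⟨χ, hχ, hχc, hχ0, hχ1⟩ := exists_cutoff n
  set e : Space n := EuclideanSpace.single i 1
  obtain ⟨C, hC⟩ := (continuous_partial i hχ).bounded_above_of_compact_support
    (hasCompactSupport_partial i hχc)
  have hC0 : 0 ≤ C := (norm_nonneg _).trans (hC 0)
  -- The cutoffs are χ(r x) with r → 0. The term in which the derivative falls on the cutoff carries
  -- a factor r and vanishes in the limit; r ≤ 1 gives an integrable majorant independent of k.
  let r : ℕ → ℝ := fun k => 1 / ((k : ℝ) + 1)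
  have hr0 : ∀ k, 0 < r k := fun k => by positivity
  have hr1 : ∀ k, r k ≤ 1 := fun k => by
    rw [div_le_one (by positivity)]
    simp
  have hr : Tendsto r atTop (𝓝 0) := tendsto_one_div_add_atTop_nhds_zero_nat
  let X : ℕ → Space n → ℝ := fun k x => χ (r k • x)
  have hX : ∀ k, ContDiff ℝ ∞ (X k) := fun k => hχ.comp (contDiff_const_smul _)
  have hXc : ∀ k, HasCompactSupport (X k) := fun k => hχc.comp_smul (hr0 k).ne'
  have hXd : ∀ k x, fderiv ℝ (X k) x e = r k * fderiv ℝ χ (r k • x) e := fun k x => by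
    have := ((hχ.differentiable (by simp)) (r k • x)).hasFDerivAt.comp x
      ((hasFDerivAt_id x).const_smul (r k))
    have h' : fderiv ℝ (X k) x = _ := this.fderiv
    rw [h']
    simp
  have hprod : ∀ k x, fderiv ℝ (fun x => X k x * ψ x) x e
      = X k x * fderiv ℝ ψ x e + ψ x * (r k * fderiv ℝ χ (r k • x) e) := fun k x => by
    rw [fderiv_fun_mul (((hX k).differentiable (by simp)) x) ((hψ.differentiable (by simp)) x)]
    simp [hXd]
  have hk := fun k => h (fun x => X k x * ψ x) ((hX k).mul hψ) (hXc k).mul_right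
  have hXlim : ∀ x, Tendsto (fun k => X k x) atTop (𝓝 1) := fun x => by
    have h1 : Tendsto (fun k => r k • x) atTop (𝓝 ((0 : ℝ) • x)) := hr.smul_const x
    rw [zero_smul] at h1
    have := (hχ.continuous.tendsto 0).comp h1
    rwa [hχ0] at this
  have hdlim : ∀ x, Tendsto (fun k => r k * fderiv ℝ χ (r k • x) e) atTop (𝓝 0) := fun x => by
    refine squeeze_zero_norm (fun k => ?_) (by simpa using hr.mul_const C)
    rw [norm_mul, Real.norm_of_nonneg (hr0 k).le]
    exact mul_le_mul_of_nonneg_left (hC _) (hr0 k).le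
  have i1 : Integrable (fun x => |f x| * |fderiv ℝ ψ x e|) := by
    simpa only [Real.norm_eq_abs, Pi.mul_apply, norm_mul] using
      (((Lp.memLp f).integrable_mul (q := 2) hd2).norm)
  have i2 : Integrable (fun x => |f x| * |ψ x|) := by
    simpa only [Real.norm_eq_abs, Pi.mul_apply, norm_mul] using
      (((Lp.memLp f).integrable_mul (q := 2) h2).norm)
  have i3 : Integrable (fun x => |g x| * |ψ x|) := by
    simpa only [Real.norm_eq_abs, Pi.mul_apply, norm_mul] using
      (((Lp.memLp g).integrable_mul (q := 2) h2).norm)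
  have hL : Tendsto (fun k => ∫ x, f x * fderiv ℝ (fun x => X k x * ψ x) x e) atTop
      (𝓝 (∫ x, f x * fderiv ℝ ψ x e)) := by
    refine tendsto_integral_of_dominated_convergence
      (fun x => |f x| * |fderiv ℝ ψ x e| + C * (|f x| * |ψ x|)) (fun k => ?_)
      (i1.add (i2.const_mul C)) (fun k => ?_) ?_
    · exact (Lp.aestronglyMeasurable f).mul
        (continuous_partial i ((hX k).mul hψ)).aestronglyMeasurable
    · refine Eventually.of_forall fun x => ?_
      rw [norm_mul, hprod, Real.norm_eq_abs, Real.norm_eq_abs]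
      have a1 : |X k x * fderiv ℝ ψ x e| ≤ |fderiv ℝ ψ x e| := by
        rw [abs_mul]
        exact mul_le_of_le_one_left (abs_nonneg _) (hχ1 _)
      have a2 : |ψ x * (r k * fderiv ℝ χ (r k • x) e)| ≤ |ψ x| * C := by
        rw [abs_mul, abs_mul, abs_of_pos (hr0 k)]
        refine mul_le_mul_of_nonneg_left ?_ (abs_nonneg _)
        exact (mul_le_of_le_one_left (abs_nonneg _) (hr1 k)).trans (hC _)
      calc _ ≤ |f x| * (|fderiv ℝ ψ x e| + |ψ x| * C) := by
            gcongr
            exact (abs_add_le _ _).trans (add_le_add a1 a2)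
        _ = _ := by ring
    · refine Eventually.of_forall fun x => ?_
      simp only [hprod]
      have := (((hXlim x).mul_const (fderiv ℝ ψ x e)).add ((hdlim x).const_mul (ψ x))).const_mul
        (f x)
      simpa using this
  have hR : Tendsto (fun k => ∫ x, g x * (X k x * ψ x)) atTop (𝓝 (∫ x, g x * ψ x)) := by
    refine tendsto_integral_of_dominated_convergence
      (fun x => |g x| * |ψ x|) (fun k => ?_) i3 (fun k => ?_) ?_
    · exact (Lp.aestronglyMeasurable g).mul
        ((hX k).continuous.mul hψ.continuous).aestronglyMeasurable
    · refine Eventually.of_forall fun x => ?_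
      rw [norm_mul, norm_mul, Real.norm_eq_abs, Real.norm_eq_abs, Real.norm_eq_abs]
      gcongr
      exact mul_le_of_le_one_left (abs_nonneg _) (hχ1 _)
    · refine Eventually.of_forall fun x => ?_
      simpa using ((hXlim x).mul_const (ψ x)).const_mul (g x)
  exact tendsto_nhds_unique hL (hR.neg.congr fun k => (hk k).symm)

end Truncation

section Complexification

/-- The inclusion of real-valued into complex-valued `L²` functions. -/
noncomputable def toC : L2 n →L[ℝ] Lp ℂ 2 (volume : Measure (Space n)) :=
  Complex.ofRealCLM.compLpL 2 volume

/-- The real part of a complex-valued `L²` function. -/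
noncomputable def reL : Lp ℂ 2 (volume : Measure (Space n)) →L[ℝ] L2 n :=
  Complex.reCLM.compLpL 2 volume

theorem coeFn_toC (f : L2 n) : toC f =ᵐ[volume] fun x => (f x : ℂ) :=
  Complex.ofRealCLM.coeFn_compLpL f

theorem coeFn_reL (f : Lp ℂ 2 (volume : Measure (Space n))) :
    reL f =ᵐ[volume] fun x => (f x).re :=
  Complex.reCLM.coeFn_compLpL f

theorem reL_toC (f : L2 n) : reL (toC f) = f := by
  refine Lp.ext ?_
  filter_upwards [coeFn_reL (toC f), coeFn_toC f] with x h1 h2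
  rw [h1, h2, Complex.ofReal_re]

theorem inner_reL (f : Lp ℂ 2 (volume : Measure (Space n))) (φ : L2 n) :
    inner ℝ (reL f) φ = (inner ℂ (toC φ) f).re := by
  rw [L2.inner_def, L2.inner_def]
  have h := integral_re (L2.integrable_inner (𝕜 := ℂ) (toC φ) f)
  refine Eq.trans (integral_congr_ae ?_) h
  filter_upwards [coeFn_reL f, coeFn_toC φ] with x h1 h2
  rw [h1, h2]
  simp [mul_comm]

end Complexification

section Fourier

theorem single_inner (i : Fin n) (ξ : Space n) :
    inner ℝ ξ (EuclideanSpace.single i (1 : ℝ)) = ξ i := by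
  simp [EuclideanSpace.inner_single_right]

theorem lineDeriv_toTempered_iff {f g : Lp ℂ 2 (volume : Measure (Space n))} {m : Space n} :
    ∂_{m} (f : 𝓢'(Space n, ℂ)) = (g : 𝓢'(Space n, ℂ)) ↔
      ∀ u : 𝓢(Space n, ℂ), ∫ x, f x * fderiv ℝ u x m = - ∫ x, g x * u x := by
  have h : ∀ u : 𝓢(Space n, ℂ), (∂_{m} (f : 𝓢'(Space n, ℂ))) u = (g : 𝓢'(Space n, ℂ)) u ↔
      ∫ x, f x * fderiv ℝ u x m = - ∫ x, g x * u x := fun u => by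
    rw [TemperedDistribution.lineDerivOp_apply_apply, map_neg, Lp.toTemperedDistribution_apply,
      Lp.toTemperedDistribution_apply, neg_eq_iff_eq_neg]
    simp only [smul_eq_mul, mul_comm _ (f _), mul_comm _ (g _), SchwartzMap.lineDerivOp_apply_eq_fderiv]
  refine ⟨fun H u => (h u).1 (DFunLike.congr_fun H u), fun H => ?_⟩
  ext u
  exact (h u).2 (H u)

theorem smulLeft_fourier_apply (m : Space n) (F : Lp ℂ 2 (volume : Measure (Space n)))
    (u : 𝓢(Space n, ℂ)) :
    ((2 * Real.pi * Complex.I) • TemperedDistribution.smulLeftCLM ℂ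
      (fun ξ => ((inner ℝ ξ m : ℝ) : ℂ)) (F : 𝓢'(Space n, ℂ))) u
      = ∫ ξ, u ξ * (2 * Real.pi * Complex.I * (inner ℝ ξ m : ℝ) * F ξ) := by
  have hT : (fun ξ : Space n => ((inner ℝ ξ m : ℝ) : ℂ)).HasTemperateGrowth := by
    fun_prop
  rw [smul_apply, TemperedDistribution.smulLeftCLM_apply_apply,
    Lp.toTemperedDistribution_apply, smul_eq_mul, ← integral_const_mul]
  congr 1 with ξ
  rw [SchwartzMap.smulLeftCLM_apply_apply hT]
  simp only [smul_eq_mul]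
  ring

/-- Weak differentiability of `L²` functions on the Fourier side. -/
theorem lineDeriv_iff_fourier {f g : Lp ℂ 2 (volume : Measure (Space n))} {m : Space n} :
    ∂_{m} (f : 𝓢'(Space n, ℂ)) = (g : 𝓢'(Space n, ℂ)) ↔
      ∀ᵐ ξ, (2 * Real.pi * Complex.I * (inner ℝ ξ m : ℝ)
        * (𝓕 f : Lp ℂ 2 (volume : Measure (Space n))) ξ : ℂ)
        = (𝓕 g : Lp ℂ 2 (volume : Measure (Space n))) ξ := by
  -- The Fourier transform is injective on tempered distributions.
  have hinj : ∂_{m} (f : 𝓢'(Space n, ℂ)) = (g : 𝓢'(Space n, ℂ)) ↔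
      𝓕 (∂_{m} (f : 𝓢'(Space n, ℂ))) = 𝓕 (g : 𝓢'(Space n, ℂ)) :=
    ⟨fun h => by rw [h], fun h => by
      have := congrArg (fun T : 𝓢'(Space n, ℂ) => 𝓕⁻ T) h
      simpa only [FourierTransform.fourierInv_fourier_eq] using this⟩
  rw [hinj, TemperedDistribution.fourier_lineDerivOp_eq, Lp.fourier_toTemperedDistribution_eq,
    Lp.fourier_toTemperedDistribution_eq]
  have hloc : ∀ k : Lp ℂ 2 (volume : Measure (Space n)), LocallyIntegrable k volume := fun k =>
    (Lp.memLp k).locallyIntegrable (by norm_num)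
  constructor
  · intro h
    -- The multiplied transform is not yet known to be in L², but it is locally integrable, and
    -- smooth compactly supported tests are Schwartz functions that determine it.
    refine ae_eq_of_integral_contDiff_smul_eq ?_ (hloc _) fun φ hφ hc => ?_
    · have hc : ContinuousOn (fun ξ : Space n =>
          (2 * Real.pi * Complex.I * (inner ℝ ξ m : ℝ) : ℂ)) univ := by fun_prop
      exact locallyIntegrableOn_univ.1
        ((locallyIntegrableOn_univ.2 (hloc (𝓕 f))).continuousOn_mul hc isOpen_univ.isLocallyClosed)
    · have hc' : HasCompactSupport (Complex.ofRealCLM ∘ φ) := hc.comp_left rfl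
      have hφ' : ContDiff ℝ ∞ (Complex.ofRealCLM ∘ φ) := by fun_prop
      have h3 := DFunLike.congr_fun h (hc'.toSchwartzMap hφ')
      rw [smulLeft_fourier_apply, Lp.toTemperedDistribution_apply] at h3
      simpa [Complex.real_smul] using h3
  · intro h
    ext u
    rw [smulLeft_fourier_apply, Lp.toTemperedDistribution_apply]
    refine integral_congr_ae ?_
    filter_upwards [h] with ξ hξ
    rw [hξ, smul_eq_mul]

theorem re_integral_toC_mul (f : L2 n) {u : Space n → ℂ} (hu : MemLp u 2) :
    (∫ x, toC f x * u x).re = ∫ x, f x * (u x).re ∧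
      (∫ x, toC f x * u x).im = ∫ x, f x * (u x).im := by
  have hi : Integrable (fun x => toC f x * u x) :=
    (Lp.memLp (toC f)).integrable_mul (q := 2) hu
  constructor
  · refine (integral_re hi).symm.trans (integral_congr_ae ?_)
    filter_upwards [coeFn_toC f] with x hx
    simp [hx]
  · refine (integral_im hi).symm.trans (integral_congr_ae ?_)
    filter_upwards [coeFn_toC f] with x hx
    simp [hx]

/-- Real and imaginary parts of a Schwartz function are smooth and in L² with their derivatives,
hence admissible in `HasWeakPartial.integral_eq` although not compactly supported. -/
theorem HasWeakPartial.lineDeriv_toC {i : Fin n} {f g : L2 n} (h : HasWeakPartial i f g) :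
    ∂_{EuclideanSpace.single i (1 : ℝ)} (toC f : 𝓢'(Space n, ℂ)) = (toC g : 𝓢'(Space n, ℂ)) := by
  refine lineDeriv_toTempered_iff.2 fun u => ?_
  set e : Space n := EuclideanSpace.single i 1
  have hu : MemLp u 2 := u.memLp 2
  have hdu : MemLp (fun x => fderiv ℝ u x e) 2 := by
    have := (∂_{e} u).memLp 2 (μ := volume)
    refine this.ae_eq (Eventually.of_forall fun x => ?_)
    rw [SchwartzMap.lineDerivOp_apply_eq_fderiv]
  have key : ∀ L : ℂ →L[ℝ] ℝ, ∫ x, f x * L (fderiv ℝ u x e) = - ∫ x, g x * L (u x) := fun L => by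
    have hd : ∀ x, fderiv ℝ (fun x => L (u x)) x e = L (fderiv ℝ u x e) := fun x => by
      have := (L.hasFDerivAt.comp x (u.differentiableAt (x := x)).hasFDerivAt).fderiv
      have h' : fderiv ℝ (fun x => L (u x)) x = _ := this
      rw [h']
      rfl
    have := h.integral_eq (ψ := fun x => L (u x)) (L.contDiff.comp (u.smooth ⊤))
      (L.comp_memLp' hu)
      ((L.comp_memLp' hdu).ae_eq (Eventually.of_forall fun x => (hd x).symm))
    change ∫ x, f x * fderiv ℝ (fun x => L (u x)) x e = _ at this
    simpa only [hd] using this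
  have h1 := re_integral_toC_mul f hdu
  have h2 := re_integral_toC_mul g hu
  refine Complex.ext ?_ ?_
  · rw [Complex.neg_re, h1.1, h2.1]
    exact key Complex.reCLM
  · rw [Complex.neg_im, h1.2, h2.2]
    exact key Complex.imCLM

theorem hasWeakPartial_reL {i : Fin n} {f g : Lp ℂ 2 (volume : Measure (Space n))}
    (h : ∂_{EuclideanSpace.single i (1 : ℝ)} (f : 𝓢'(Space n, ℂ)) = (g : 𝓢'(Space n, ℂ))) :
    HasWeakPartial i (reL f) (reL g) := by
  intro φ hφ hc
  set e : Space n := EuclideanSpace.single i 1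
  have hc' : HasCompactSupport (Complex.ofRealCLM ∘ φ) := hc.comp_left rfl
  have hφ' : ContDiff ℝ ∞ (Complex.ofRealCLM ∘ φ) := by fun_prop
  have h1 := lineDeriv_toTempered_iff.1 h (hc'.toSchwartzMap hφ')
  have hd : ∀ x, fderiv ℝ (hc'.toSchwartzMap hφ') x e = ((fderiv ℝ φ x e : ℝ) : ℂ) := fun x => by
    have := (Complex.ofRealCLM.hasFDerivAt.comp x
      ((hφ.differentiable (by simp)) x).hasFDerivAt).fderiv
    have h' : fderiv ℝ (hc'.toSchwartzMap hφ') x = _ := this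
    rw [h']
    rfl
  simp only [hd] at h1
  have hre : ∀ (k : Lp ℂ 2 (volume : Measure (Space n))) (v : Space n → ℝ), Continuous v →
      HasCompactSupport v → (∫ x, k x * (v x : ℂ)).re = ∫ x, reL k x * v x := by
    intro k v hv hvc
    have hi : Integrable (fun x => k x * (v x : ℂ)) :=
      (Lp.memLp k).integrable_mul (q := 2)
        (hv.memLp_of_hasCompactSupport hvc).ofReal
    refine (integral_re hi).symm.trans (integral_congr_ae ?_)
    filter_upwards [coeFn_reL k] with x hx
    simp [hx]
  have h2 := congrArg Complex.re h1
  rw [Complex.neg_re, hre f _ (continuous_partial i hφ) (hasCompactSupport_partial i hc)] at h2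
  rw [h2, ← hre g φ hφ.continuous hc]
  rfl

end Fourier

end PlateEq

/-! ### Energy identity, uniqueness and the L² bound -/

namespace PlateEq

theorem eq_of_hasDerivAt_zero {g : ℝ → ℝ} (hc : ContinuousOn g (Ici 0))
    (hd : ∀ t, 0 < t → HasDerivAt g 0 t) {t : ℝ} (ht : 0 ≤ t) : g t = g 0 := by
  rcases ht.eq_or_lt with rfl | ht
  · rfl
  obtain ⟨c, -, hc⟩ := exists_hasDerivAt_eq_slope g (fun _ => 0) ht
    (hc.mono Icc_subset_Ici_self) (fun x hx => hd x hx.1)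
  rw [eq_div_iff (by simpa using ht.ne')] at hc
  linarith

variable {n : ℕ}

theorem H2.continuous_toL2 : Continuous (H2.toL2 (n := n)) :=
  continuous_fst.comp continuous_subtype_val

theorem H2.continuous_laplacian : Continuous (H2.laplacian (n := n)) := by
  unfold H2.laplacian
  fun_prop

theorem H2.toL2_sub (f g : H2 n) : H2.toL2 (f - g) = H2.toL2 f - H2.toL2 g := rfl

theorem H2.laplacian_sub (f g : H2 n) :
    H2.laplacian (f - g) = H2.laplacian f - H2.laplacian g := by
  simp [H2.laplacian]

variable {V : Space n →ᵇ ℝ} {u₀ u₀' : H2 n} {u₁ u₁' : L2 n} {w w' : ℝ → H2 n}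

theorem IsWeakSolution.hasDerivWithinAt (h : IsWeakSolution V u₀ u₁ w) {t : ℝ} (ht : 0 ≤ t) :
    HasDerivWithinAt (fun s => H2.toL2 (w s)) (timeDeriv w t) (Ici 0) t :=
  (h.contDiffOn.differentiableOn (by simp) t ht).hasDerivWithinAt

theorem IsWeakSolution.hasDerivAt (h : IsWeakSolution V u₀ u₁ w) {t : ℝ} (ht : 0 < t) :
    HasDerivAt (fun s => H2.toL2 (w s)) (timeDeriv w t) t :=
  (h.hasDerivWithinAt ht.le).hasDerivAt (Ici_mem_nhds ht)

theorem IsWeakSolution.continuousOn_timeDeriv (h : IsWeakSolution V u₀ u₁ w) :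
    ContinuousOn (timeDeriv w) (Ici 0) :=
  h.contDiffOn.continuousOn_derivWithin (uniqueDiffOn_Ici 0) le_rfl

theorem IsWeakSolution.weak' (h : IsWeakSolution V u₀ u₁ w) (φ : H2 n) {t : ℝ} (ht : 0 < t) :
    HasDerivAt (fun s => inner ℝ (timeDeriv w s) (H2.toL2 φ))
      (-(inner ℝ (H2.laplacian (w t)) (H2.laplacian φ)
        + inner ℝ (mulL volume V (H2.toL2 (w t))) (H2.toL2 φ))) t := by
  rw [inner_mulL_real]
  exact h.weak φ t ht

theorem IsWeakSolution.sub (h : IsWeakSolution V u₀ u₁ w) (h' : IsWeakSolution V u₀' u₁' w') :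
    IsWeakSolution V (u₀ - u₀') (u₁ - u₁') (fun t => w t - w' t) := by
  have hd : ∀ t, 0 ≤ t → timeDeriv (fun t => w t - w' t) t = timeDeriv w t - timeDeriv w' t :=
    fun t ht => ((h.hasDerivWithinAt ht).sub (h'.hasDerivWithinAt ht)).derivWithin
      (uniqueDiffOn_Ici 0 t ht)
  refine ⟨h.continuousOn.sub h'.continuousOn, h.contDiffOn.sub h'.contDiffOn, ?_, ?_, ?_⟩
  · rw [h.init, h'.init]
  · rw [hd 0 le_rfl, h.init_deriv, h'.init_deriv]
  · intro φ t ht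
    have := (h.weak' φ ht).sub (h'.weak' φ ht)
    rw [← inner_mulL_real, H2.toL2_sub, H2.laplacian_sub, map_sub, inner_sub_left,
      inner_sub_left]
    convert! this.congr_of_eventuallyEq ?_ using 1
    · ring
    · filter_upwards [Ioi_mem_nhds ht] with s hs
      rw [hd s (le_of_lt hs), inner_sub_left, Pi.sub_apply]

/-- The time primitive `∫₀ᵗ F(w(s)) ds` of a function of a curve on `[0, ∞)`. -/
noncomputable def primitive (F : H2 n → L2 n) (w : ℝ → H2 n) (t : ℝ) : L2 n :=
  ∫ s in (0 : ℝ)..t, F (w (max s 0))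

theorem primitive_zero (F : H2 n → L2 n) (w : ℝ → H2 n) : primitive F w 0 = 0 := by
  simp [primitive]

/-- Freezing the curve through `max s 0` makes the integrand continuous on all of ℝ, whatever `w`
does at negative times, so the derivative is two-sided even at t = 0. -/
theorem hasDerivAt_primitive {F : H2 n → L2 n} (hF : Continuous F)
    (hw : ContinuousOn w (Ici 0)) {t : ℝ} (ht : 0 ≤ t) :
    HasDerivAt (primitive F w) (F (w t)) t := by
  have hc : Continuous fun s => F (w (max s 0)) :=
    hF.comp (hw.comp_continuous (by fun_prop) fun s => mem_Ici.2 (le_max_right _ _))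
  have := (hc.integral_hasStrictDerivAt 0 t).hasDerivAt
  rwa [max_eq_left ht] at this

theorem continuousOn_primitive {F : H2 n → L2 n} (hF : Continuous F)
    (hw : ContinuousOn w (Ici 0)) : ContinuousOn (primitive F w) (Ici 0) :=
  fun _ ht => (hasDerivAt_primitive hF hw ht).continuousAt.continuousWithinAt

/-- The integrated equation contains no derivative of an inner product, so at each fixed time φ may
be replaced by a function depending on that time. -/
theorem IsWeakSolution.integrated (h : IsWeakSolution V u₀ u₁ w) (φ : H2 n) {t : ℝ} (ht : 0 ≤ t) :
    inner ℝ (timeDeriv w t) (H2.toL2 φ)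
      + inner ℝ (primitive H2.laplacian w t) (H2.laplacian φ)
      + inner ℝ (mulL volume V (primitive H2.toL2 w t)) (H2.toL2 φ) = inner ℝ u₁ (H2.toL2 φ) := by
  have hW := fun s hs =>
    hasDerivAt_primitive (n := n) H2.continuous_toL2 h.continuousOn (t := s) hs
  have hD := fun s hs =>
    hasDerivAt_primitive (n := n) H2.continuous_laplacian h.continuousOn (t := s) hs
  have key := eq_of_hasDerivAt_zero (g := fun s => inner ℝ (timeDeriv w s) (H2.toL2 φ)
      + inner ℝ (primitive H2.laplacian w s) (H2.laplacian φ)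
      + inner ℝ (mulL volume V (primitive H2.toL2 w s)) (H2.toL2 φ)) ?_ ?_ ht
  · simpa [primitive_zero, h.init_deriv] using key
  · exact ((h.continuousOn_timeDeriv.inner continuousOn_const).add
      ((continuousOn_primitive H2.continuous_laplacian h.continuousOn).inner
        continuousOn_const)).add
      (((mulL volume V).continuous.comp_continuousOn
        (continuousOn_primitive H2.continuous_toL2 h.continuousOn)).inner continuousOn_const)
  · intro s hs
    have h1 := (hD s hs.le).inner ℝ (hasDerivAt_const s (H2.laplacian φ))
    have h2 := ((mulL volume V).hasFDerivAt.comp_hasDerivAt s (hW s hs.le)).inner ℝ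
      (hasDerivAt_const s (H2.toL2 φ))
    convert! ((h.weak' φ hs).add h1).add h2 using 1
    simp

/-- Energy identity for the time primitive of a weak solution. -/
theorem IsWeakSolution.energy (h : IsWeakSolution V u₀ u₁ w) {t : ℝ} (ht : 0 ≤ t) :
    ‖H2.toL2 (w t)‖ ^ 2 + ‖primitive H2.laplacian w t‖ ^ 2
      + inner ℝ (mulL volume V (primitive H2.toL2 w t)) (primitive H2.toL2 w t)
      = ‖H2.toL2 u₀‖ ^ 2 + 2 * inner ℝ u₁ (primitive H2.toL2 w t) := by
  have hW := fun s hs =>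
    hasDerivAt_primitive (n := n) H2.continuous_toL2 h.continuousOn (t := s) hs
  have hD := fun s hs =>
    hasDerivAt_primitive (n := n) H2.continuous_laplacian h.continuousOn (t := s) hs
  have cW := continuousOn_primitive (n := n) H2.continuous_toL2 h.continuousOn
  have cD := continuousOn_primitive (n := n) H2.continuous_laplacian h.continuousOn
  have key := eq_of_hasDerivAt_zero (g := fun s =>
      inner ℝ (H2.toL2 (w s)) (H2.toL2 (w s))
      + inner ℝ (primitive H2.laplacian w s) (primitive H2.laplacian w s)
      + inner ℝ (mulL volume V (primitive H2.toL2 w s)) (primitive H2.toL2 w s)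
      - 2 * inner ℝ u₁ (primitive H2.toL2 w s)) ?_ ?_ ht
  · simp only [primitive_zero, h.init, map_zero, inner_zero_right,
      real_inner_self_eq_norm_sq] at key
    linarith
  · have cw := H2.continuous_toL2.comp_continuousOn h.continuousOn
    exact (((cw.inner cw).add (cD.inner cD)).add
      (((mulL volume V).continuous.comp_continuousOn cW).inner cW)).sub
      (continuousOn_const.mul (continuousOn_const.inner cW))
  · intro s hs
    have h0 := (h.hasDerivAt hs).inner ℝ (h.hasDerivAt hs)
    have h1 := (hD s hs.le).inner ℝ (hD s hs.le)
    have h2 := ((mulL volume V).hasFDerivAt.comp_hasDerivAt s (hW s hs.le)).inner ℝ (hW s hs.le)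
    have h3 := ((hasDerivAt_const s u₁).inner ℝ (hW s hs.le)).const_mul 2
    -- Testing with the solution itself at time s: the derivative of the energy is twice the defect
    -- of this identity.
    have hi := h.integrated (w s) hs.le
    convert! ((h0.add h1).add h2).sub h3 using 1
    simp only [Function.comp_apply, inner_zero_left, add_zero]
    rw [inner_mulL_real_comm V (H2.toL2 (w s)), real_inner_comm (timeDeriv w s) (H2.toL2 (w s)),
      real_inner_comm (primitive H2.laplacian w s) (H2.laplacian (w s))]
    linarith

theorem inner_mulL_nonneg (hV : ∀ x, 0 ≤ V x) (f : L2 n) :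
    0 ≤ inner ℝ (mulL volume V f) f := by
  rw [inner_mulL_real]
  refine integral_nonneg fun x => ?_
  have := mul_nonneg (hV x) (mul_self_nonneg (f x))
  simpa [mul_assoc] using this

/-- With zero data the energy identity makes a sum of nonnegative terms vanish, among them the
squared norm of the difference. -/
theorem IsWeakSolution.unique (hV : ∀ x, 0 ≤ V x) (h : IsWeakSolution V u₀ u₁ w)
    (h' : IsWeakSolution V u₀ u₁ w') {t : ℝ} (ht : 0 ≤ t) : w t = w' t := by
  have hs := h.sub h'
  rw [sub_self, sub_self] at hs
  have he := hs.energy ht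
  rw [inner_zero_left, H2.toL2_sub] at he
  have h0 : H2.toL2 (0 : H2 n) = 0 := rfl
  rw [h0, norm_zero] at he
  have := inner_mulL_nonneg hV (primitive H2.toL2 (fun t => w t - w' t) t)
  have hz : ‖H2.toL2 (w t) - H2.toL2 (w' t)‖ ^ 2 = 0 := by
    nlinarith [sq_nonneg ‖H2.toL2 (w t) - H2.toL2 (w' t)‖,
      sq_nonneg ‖primitive H2.laplacian (fun t => w t - w' t) t‖]
  exact H2.toL2_injective (sub_eq_zero.1 (norm_eq_zero.1 (pow_eq_zero_iff two_ne_zero |>.1 hz)))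

/-- By the Lindelöf property a countable subfamily already covers the union, so the exceptional null
sets can be united. -/
theorem ae_eq_zero_of_notMem_essSupp (f : L2 n) : ∀ᵐ x, x ∉ essSupp f → f x = 0 := by
  set S := {U : Set (Space n) | IsOpen U ∧ ∀ᵐ x, x ∈ U → f x = 0}
  obtain ⟨T, hTc, hTS, hT⟩ := TopologicalSpace.isOpen_sUnion_countable S fun U hU => hU.1
  have : ∀ᵐ x, ∀ U ∈ T, x ∈ U → f x = 0 := (ae_ball_iff hTc).2 fun U hU => (hTS hU).2
  filter_upwards [this] with x hx hxS
  have hxS' : x ∈ ⋃₀ S := not_not.1 hxS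
  rw [← hT] at hxS'
  obtain ⟨U, hU, hxU⟩ := hxS'
  exact hx U hU hxU

/-- Inside Ω the difference of the integrands is the square (u₁ - V f)²/V; outside, u₁ vanishes
almost everywhere and V f² ≥ 0. -/
theorem two_mul_inner_le {Ω : Set (Space n)} (hΩ : IsOpen Ω) (hpos : ∀ x ∈ Ω, 0 < V x)
    (hV : ∀ x, 0 ≤ V x) (hs : essSupp u₁ ⊆ Ω)
    (hi : IntegrableOn (fun x => |u₁ x| ^ 2 / V x) Ω volume) (f : L2 n) :
    2 * inner ℝ u₁ f ≤ (∫ x in Ω, |u₁ x| ^ 2 / V x) + inner ℝ (mulL volume V f) f := by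
  have hI : Integrable (fun x => V x * f x * f x) := by
    have := L2.integrable_inner (𝕜 := ℝ) (mulL volume V f) f
    refine this.congr ?_
    filter_upwards [coeFn_mulL V f] with x hx
    rw [hx]
    simp [mul_comm]
  have hJ : Integrable (fun x => u₁ x * f x) :=
    (Lp.memLp u₁).integrable_mul (q := 2) (Lp.memLp f)
  have he : inner ℝ u₁ f = ∫ x, u₁ x * f x := by
    rw [L2.inner_def]
    congr 1 with x
    simp [mul_comm]
  rw [he, inner_mulL_real, ← integral_indicator hΩ.measurableSet, ← integral_const_mul,
    ← integral_add ((integrable_indicator_iff hΩ.measurableSet).2 hi) hI]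
  refine integral_mono_ae (hJ.const_mul 2)
    (((integrable_indicator_iff hΩ.measurableSet).2 hi).add hI) ?_
  filter_upwards [ae_eq_zero_of_notMem_essSupp u₁] with x hx
  by_cases hxΩ : x ∈ Ω
  · have hp := hpos x hxΩ
    simp only [indicator_of_mem hxΩ, sq_abs]
    have : u₁ x ^ 2 / V x + V x * f x * f x - 2 * (u₁ x * f x)
        = (u₁ x - V x * f x) ^ 2 / V x := by
      field_simp
      ring
    have := div_nonneg (sq_nonneg (u₁ x - V x * f x)) hp.le
    linarith
  · simp only [indicator_of_notMem hxΩ, hx fun h => hxΩ (hs h)]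
    have := mul_nonneg (hV x) (mul_self_nonneg (f x))
    linarith

theorem IsWeakSolution.norm_sq_le {Ω : Set (Space n)} (hΩ : IsOpen Ω) (hpos : ∀ x ∈ Ω, 0 < V x)
    (hV : ∀ x, 0 ≤ V x) (hs : essSupp u₁ ⊆ Ω)
    (hi : IntegrableOn (fun x => |u₁ x| ^ 2 / V x) Ω volume) (h : IsWeakSolution V u₀ u₁ w)
    {t : ℝ} (ht : 0 ≤ t) :
    ‖H2.toL2 (w t)‖ ^ 2 ≤ ‖H2.toL2 u₀‖ ^ 2 + ∫ x in Ω, |u₁ x| ^ 2 / V x := by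
  have h1 := h.energy ht
  have h2 := two_mul_inner_le hΩ hpos hV hs hi (primitive H2.toL2 w t)
  nlinarith [sq_nonneg ‖primitive H2.laplacian w t‖]

end PlateEq

/-! ### Fourier description of H² and existence -/

namespace PlateEq

open Filter Topology
open scoped SchwartzMap FourierTransform LineDeriv

variable {n : ℕ}

section Symbols

/-- The frequency variable dual to `∂ᵢ`. -/
noncomputable def freq (i : Fin n) (ξ : Space n) : ℝ := 2 * Real.pi * ξ i

/-- The symbol of `-Δ`. -/
noncomputable def freqSq (ξ : Space n) : ℝ := ∑ i, freq i ξ * freq i ξ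

theorem continuous_freq (i : Fin n) : Continuous (freq i) := by
  unfold freq
  fun_prop

theorem continuous_freqSq : Continuous (freqSq (n := n)) :=
  continuous_finsetSum _ fun i _ => (continuous_freq i).mul (continuous_freq i)

/-- The symbol of `(1 + Δ²)^{1/2}`. -/
noncomputable def weight (n : ℕ) : C(Space n, ℝ) :=
  ⟨fun ξ => Real.sqrt (1 + freqSq ξ ^ 2), by
    have := continuous_freqSq (n := n)
    fun_prop⟩

theorem weight_sq (ξ : Space n) : weight n ξ ^ 2 = 1 + freqSq ξ ^ 2 :=
  Real.sq_sqrt (by positivity)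

theorem one_le_weight (ξ : Space n) : 1 ≤ weight n ξ :=
  Real.one_le_sqrt.2 (by nlinarith [sq_nonneg (freqSq ξ)])

theorem weight_pos (ξ : Space n) : 0 < weight n ξ := one_pos.trans_le (one_le_weight ξ)

theorem freqSq_nonneg (ξ : Space n) : 0 ≤ freqSq ξ :=
  Finset.sum_nonneg fun i _ => mul_self_nonneg (freq i ξ)

theorem abs_freqSq_le (ξ : Space n) : |freqSq ξ| ≤ weight n ξ :=
  Real.abs_le_sqrt (by linarith)

theorem freq_mul_self_le (i : Fin n) (ξ : Space n) : freq i ξ * freq i ξ ≤ freqSq ξ :=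
  Finset.single_le_sum (f := fun i => freq i ξ * freq i ξ)
    (fun i _ => mul_self_nonneg (freq i ξ)) (Finset.mem_univ i)

theorem abs_freq_mul_le (i j : Fin n) (ξ : Space n) : |freq i ξ * freq j ξ| ≤ weight n ξ := by
  refine le_trans ?_ ((le_abs_self _).trans (abs_freqSq_le ξ))
  rw [abs_le]
  constructor <;>
  nlinarith [freq_mul_self_le i ξ, freq_mul_self_le j ξ, sq_nonneg (freq i ξ + freq j ξ),
    sq_nonneg (freq i ξ - freq j ξ)]

theorem abs_freq_le (i : Fin n) (ξ : Space n) : |freq i ξ| ≤ weight n ξ := by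
  refine Real.abs_le_sqrt ?_
  nlinarith [freq_mul_self_le i ξ, sq_nonneg (freqSq ξ - 1)]

/-- The bounded symbol `f/w`, for the weight `w`. -/
noncomputable def overWeight (f : Space n → ℝ) (hf : Continuous f) (hb : ∀ ξ, |f ξ| ≤ weight n ξ) :
    Space n →ᵇ ℂ :=
  BoundedContinuousFunction.ofNormedAddCommGroup (fun ξ => (f ξ / weight n ξ : ℝ))
    (Complex.continuous_ofReal.comp
      (hf.div (weight n).continuous fun ξ => (weight_pos ξ).ne')) 1 fun ξ => by
    rw [Complex.norm_real, Real.norm_eq_abs, abs_div, abs_of_pos (weight_pos ξ)]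
    exact div_le_one_of_le₀ (hb ξ) (weight_pos ξ).le

/-- The symbol of `(1 + Δ²)^{-1/2}`. -/
noncomputable def resolventSymbol (n : ℕ) : Space n →ᵇ ℂ := recip (w := weight n) one_le_weight

/-- The symbol of `∂ᵢ (1 + Δ²)^{-1/2}`. -/
noncomputable def partialSymbol (i : Fin n) : Space n →ᵇ ℂ :=
  Complex.I • overWeight (freq i) (continuous_freq i) (abs_freq_le i)

/-- The symbol of `∂ⱼ∂ᵢ (1 + Δ²)^{-1/2}`. -/
noncomputable def partialPartialSymbol (i j : Fin n) : Space n →ᵇ ℂ :=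
  -overWeight (fun ξ => freq i ξ * freq j ξ) ((continuous_freq i).mul (continuous_freq j))
    (abs_freq_mul_le i j)

/-- The symbol of `Δ (1 + Δ²)^{-1/2}`. -/
noncomputable def laplacianSymbol (n : ℕ) : Space n →ᵇ ℂ :=
  -overWeight freqSq continuous_freqSq abs_freqSq_le

theorem resolventSymbol_apply (ξ : Space n) :
    resolventSymbol n ξ = ((weight n ξ : ℝ) : ℂ)⁻¹ := by
  rw [resolventSymbol, recip_apply, Complex.ofReal_inv]

theorem partialSymbol_apply (i : Fin n) (ξ : Space n) :
    partialSymbol i ξ = Complex.I * freq i ξ * ((weight n ξ : ℝ) : ℂ)⁻¹ := by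
  have : partialSymbol i ξ = Complex.I * ((freq i ξ / weight n ξ : ℝ) : ℂ) := rfl
  rw [this]
  push_cast
  ring

theorem partialPartialSymbol_apply (i j : Fin n) (ξ : Space n) :
    partialPartialSymbol i j ξ = -(freq i ξ * freq j ξ) * ((weight n ξ : ℝ) : ℂ)⁻¹ := by
  have : partialPartialSymbol i j ξ = -((freq i ξ * freq j ξ / weight n ξ : ℝ) : ℂ) := rfl
  rw [this]
  push_cast
  ring

theorem laplacianSymbol_apply (ξ : Space n) :
    laplacianSymbol n ξ = -(freqSq ξ) * ((weight n ξ : ℝ) : ℂ)⁻¹ := by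
  have : laplacianSymbol n ξ = -((freqSq ξ / weight n ξ : ℝ) : ℂ) := rfl
  rw [this]
  push_cast
  ring

theorem sum_partialPartialSymbol : ∑ i, partialPartialSymbol i i = laplacianSymbol n := by
  ext ξ
  rw [BoundedContinuousFunction.sum_apply, laplacianSymbol_apply]
  simp only [partialPartialSymbol_apply, ← Finset.sum_mul, Finset.sum_neg_distrib]
  congr 2
  simp [freqSq]

theorem star_resolventSymbol : star (resolventSymbol n) = resolventSymbol n := by
  ext ξ
  rw [BoundedContinuousFunction.star_apply, resolventSymbol_apply]
  simp

theorem star_laplacianSymbol : star (laplacianSymbol n) = laplacianSymbol n := by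
  ext ξ
  rw [BoundedContinuousFunction.star_apply, laplacianSymbol_apply]
  simp

/-- This is |2πξ|⁴ = w² - 1 divided by w². It expresses the form (Δu, Δφ) through a = w u and the
bounded resolvent alone. -/
theorem laplacianSymbol_mul_self : laplacianSymbol n * laplacianSymbol n
    = 1 - resolventSymbol n * resolventSymbol n := by
  ext ξ
  have h : ((weight n ξ : ℝ) : ℂ) ≠ 0 := by exact_mod_cast (weight_pos ξ).ne'
  have h2 : ((weight n ξ : ℝ) : ℂ) ^ 2 = 1 + (freqSq ξ : ℂ) ^ 2 := by exact_mod_cast weight_sq ξ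
  rw [BoundedContinuousFunction.sub_apply, BoundedContinuousFunction.mul_apply,
    BoundedContinuousFunction.mul_apply, BoundedContinuousFunction.coe_one, Pi.one_apply,
    laplacianSymbol_apply, resolventSymbol_apply]
  field_simp
  linear_combination -h2

end Symbols

section Sobolev

/-- The Fourier transform on `L²`. -/
noncomputable abbrev FT (n : ℕ) :
    Lp ℂ 2 (volume : Measure (Space n)) ≃ₗᵢ[ℂ] Lp ℂ 2 (volume : Measure (Space n)) :=
  Lp.fourierTransformₗᵢ (Space n) ℂ

theorem sum_mulL {ι : Type*} (s : Finset ι) (f : ι → Space n →ᵇ ℂ)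
    (c : Lp ℂ 2 (volume : Measure (Space n))) :
    ∑ i ∈ s, mulL volume (f i) c = mulL volume (∑ i ∈ s, f i) c :=
  (map_sum (AddMonoidHom.ofMapSub (fun g => mulL volume g c) fun g h => mulL_sub g h c) f s).symm

theorem lineDeriv_iff_freq {f g : Lp ℂ 2 (volume : Measure (Space n))} {i : Fin n} :
    ∂_{EuclideanSpace.single i (1 : ℝ)} (f : 𝓢'(Space n, ℂ)) = (g : 𝓢'(Space n, ℂ)) ↔
      ∀ᵐ ξ, Complex.I * freq i ξ * FT n f ξ = FT n g ξ := by
  rw [lineDeriv_iff_fourier]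
  simp only [single_inner]
  have : ∀ ξ : Space n, (2 * Real.pi * Complex.I * ξ i : ℂ) = Complex.I * freq i ξ := fun ξ => by
    simp only [freq]
    push_cast
    ring
  simp only [this]
  rfl

theorem lineDeriv_of_symbol {s t : Space n →ᵇ ℂ} {i : Fin n}
    (h : ∀ ξ, Complex.I * freq i ξ * s ξ = t ξ) (c : Lp ℂ 2 (volume : Measure (Space n))) :
    ∂_{EuclideanSpace.single i (1 : ℝ)} ((FT n).symm (mulL volume s c) : 𝓢'(Space n, ℂ))
      = ((FT n).symm (mulL volume t c) : 𝓢'(Space n, ℂ)) := by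
  rw [lineDeriv_iff_freq, LinearIsometryEquiv.apply_symm_apply,
    LinearIsometryEquiv.apply_symm_apply]
  filter_upwards [coeFn_mulL s c, coeFn_mulL t c] with ξ h1 h2
  rw [h1, h2, ← h]
  ring

/-- The operator `Re (1 + Δ²)^{-1/2}` from `L²` to `H²`, composed with the inverse Fourier
transform. -/
noncomputable def toH2 (c : Lp ℂ 2 (volume : Measure (Space n))) : H2 n :=
  ⟨(reL ((FT n).symm (mulL volume (resolventSymbol n) c)),
    fun i => reL ((FT n).symm (mulL volume (partialSymbol i) c)),
    fun i j => reL ((FT n).symm (mulL volume (partialPartialSymbol i j) c))),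
    fun i => hasWeakPartial_reL (lineDeriv_of_symbol (fun ξ => by
      rw [partialSymbol_apply, resolventSymbol_apply]) c),
    fun i j => hasWeakPartial_reL (lineDeriv_of_symbol (fun ξ => by
      rw [partialSymbol_apply, partialPartialSymbol_apply]
      linear_combination (freq i ξ * freq j ξ * ((weight n ξ : ℝ) : ℂ)⁻¹) * Complex.I_mul_I) c)⟩

theorem continuous_toH2 : Continuous (toH2 (n := n)) := by
  have h : ∀ s : Space n →ᵇ ℂ, Continuous fun c => reL ((FT n).symm (mulL volume s c)) :=
    fun s => reL.continuous.comp ((FT n).symm.continuous.comp (mulL volume s).continuous)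
  exact Continuous.subtype_mk ((h _).prodMk ((continuous_pi fun i => h _).prodMk
    (continuous_pi fun i => continuous_pi fun j => h _))) _

theorem toL2_toH2 (c : Lp ℂ 2 (volume : Measure (Space n))) :
    H2.toL2 (toH2 c) = reL ((FT n).symm (mulL volume (resolventSymbol n) c)) := rfl

theorem laplacian_toH2 (c : Lp ℂ 2 (volume : Measure (Space n))) :
    H2.laplacian (toH2 c) = reL ((FT n).symm (mulL volume (laplacianSymbol n) c)) := by
  rw [← sum_partialPartialSymbol, ← sum_mulL, map_sum, map_sum]
  rfl

/-- The witness is c = w F, with F the transform of φ. It is in L² because w ≤ 1 + |2πξ|² and the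
pure second derivatives of φ put |2πξ|² F in L². -/
theorem exists_fourier_repr (φ : H2 n) : ∃ c : Lp ℂ 2 (volume : Measure (Space n)),
    toH2 c = φ ∧ FT n (toC (H2.toL2 φ)) = mulL volume (resolventSymbol n) c ∧
      FT n (toC (H2.laplacian φ)) = mulL volume (laplacianSymbol n) c := by
  set F := FT n (toC (H2.toL2 φ)) with hF
  have hG : ∀ i, ∀ᵐ ξ, FT n (toC (φ.1.2.2 i i)) ξ = -(freq i ξ * freq i ξ) * F ξ := fun i => by
    filter_upwards [lineDeriv_iff_freq.1 (φ.2.1 i).lineDeriv_toC,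
      lineDeriv_iff_freq.1 (φ.2.2 i i).lineDeriv_toC] with ξ h1 h2
    rw [← h2, ← h1]
    change _ = -(freq i ξ * freq i ξ) * FT n (toC φ.1.1) ξ
    linear_combination (freq i ξ * freq i ξ * FT n (toC φ.1.1) ξ) * Complex.I_mul_I
  have hmem : MemLp (fun ξ => ((freqSq ξ : ℝ) : ℂ) * F ξ) 2 := by
    have h : ∀ i : Fin n, MemLp (fun ξ => ((freq i ξ * freq i ξ : ℝ) : ℂ) * F ξ) 2 := fun i => by
      refine (Lp.memLp (-FT n (toC (φ.1.2.2 i i)))).ae_eq ?_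
      filter_upwards [hG i, Lp.coeFn_neg (FT n (toC (φ.1.2.2 i i)))] with ξ h1 h2
      rw [h2, Pi.neg_apply, h1]
      push_cast
      ring
    have := memLp_finsetSum Finset.univ fun i _ => h i
    refine this.ae_eq (Eventually.of_forall fun ξ => ?_)
    simp [freqSq, Finset.sum_mul]
  have hmem' : MemLp (fun ξ => ((weight n ξ : ℝ) : ℂ) * F ξ) 2 := by
    refine MemLp.of_le ((Lp.memLp F).norm.add hmem.norm)
      ((Complex.continuous_ofReal.comp (weight n).continuous).aestronglyMeasurable.mul
        (Lp.aestronglyMeasurable F)) (Eventually.of_forall fun ξ => ?_)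
    rw [Pi.add_apply, Real.norm_of_nonneg (by positivity), norm_mul, norm_mul, Complex.norm_real,
      Complex.norm_real, Real.norm_of_nonneg (weight_pos ξ).le,
      Real.norm_of_nonneg (freqSq_nonneg ξ)]
    have : weight n ξ ≤ 1 + freqSq ξ := by
      refine Real.sqrt_le_iff.2 ⟨by linarith [freqSq_nonneg ξ], by nlinarith [freqSq_nonneg ξ]⟩
    nlinarith [norm_nonneg (F ξ)]
  set c := hmem'.toLp
  have hw : ∀ ξ : Space n, ((weight n ξ : ℝ) : ℂ) ≠ 0 := fun ξ => by
    exact_mod_cast (weight_pos ξ).ne'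
  have h1 : F = mulL volume (resolventSymbol n) c := by
    refine Lp.ext ?_
    filter_upwards [coeFn_mulL (resolventSymbol n) c, hmem'.coeFn_toLp] with ξ h1 h2
    rw [h1, h2, resolventSymbol_apply, inv_mul_cancel_left₀ (hw ξ)]
  have h2 : ∀ i, FT n (toC (φ.1.2.2 i i)) = mulL volume (partialPartialSymbol i i) c := fun i => by
    refine Lp.ext ?_
    filter_upwards [coeFn_mulL (partialPartialSymbol i i) c, hmem'.coeFn_toLp, hG i]
      with ξ h1 h2 h3
    rw [h1, h2, h3, partialPartialSymbol_apply, mul_assoc, inv_mul_cancel_left₀ (hw ξ)]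
  refine ⟨c, H2.toL2_injective ?_, h1, ?_⟩
  · rw [toL2_toH2, ← h1, hF, LinearIsometryEquiv.symm_apply_apply, reL_toC]
  · rw [← sum_partialPartialSymbol, ← sum_mulL, H2.laplacian, map_sum, map_sum]
    exact Finset.sum_congr rfl fun i _ => h2 i

end Sobolev

section Existence

/-- A real bounded continuous function, viewed as a complex one. -/
noncomputable def complexify (V : Space n →ᵇ ℝ) : Space n →ᵇ ℂ :=
  BoundedContinuousFunction.ofNormedAddCommGroup (fun x => (V x : ℂ))
    (Complex.continuous_ofReal.comp V.continuous) ‖V‖ fun x => by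
    rw [Complex.norm_real]
    exact V.norm_coe_le_norm x

/-- Because V is real, taking the real part preserves the equation; the complex solution need not be
shown to be real. -/
theorem mulL_reL (V : Space n →ᵇ ℝ) (f : Lp ℂ 2 (volume : Measure (Space n))) :
    mulL volume V (reL f) = reL (mulL volume (complexify V) f) := by
  refine Lp.ext ?_
  filter_upwards [coeFn_mulL V (reL f), coeFn_reL f, coeFn_reL (mulL volume (complexify V) f),
    coeFn_mulL (complexify V) f] with x h1 h2 h3 h4
  rw [h1, h2, h3, h4]
  simp [complexify]

theorem inner_reL_FT (x : Lp ℂ 2 (volume : Measure (Space n))) (φ : L2 n) :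
    inner ℝ (reL ((FT n).symm x)) φ = (inner ℂ (FT n (toC φ)) x).re := by
  rw [inner_reL, ← (FT n).inner_map_map, LinearIsometryEquiv.apply_symm_apply]

theorem exists_isWeakSolution (V : Space n →ᵇ ℝ) (u₀ : H2 n) (u₁ : L2 n) :
    ∃ u : ℝ → H2 n, IsWeakSolution V u₀ u₁ u := by
  obtain ⟨c₀, hc₀, -, -⟩ := exists_fourier_repr u₀
  set M := mulL volume (resolventSymbol n) with hM
  set L := mulL volume (laplacianSymbol n) with hL
  set P : Lp ℂ 2 (volume : Measure (Space n)) →L[ℂ] Lp ℂ 2 (volume : Measure (Space n)) :=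
    ((FT n).toContinuousLinearEquiv.toContinuousLinearMap.comp
      (mulL volume (complexify V))).comp
      (FT n).symm.toContinuousLinearEquiv.toContinuousLinearMap with hP
  have hPa : ∀ x, P x = FT n (mulL volume (complexify V) ((FT n).symm x)) := fun x => rfl
  -- The identity in the forcing compensates the 1 in w² = 1 + |2πξ|⁴, which was added to make 1/w
  -- bounded. `P` is multiplication by V conjugated by the Fourier transform.
  obtain ⟨a, b, ha, hb, ha0, hb0, hda, hdb⟩ := exists_wave (w := weight n) (μ := volume)
    one_le_weight (ContinuousLinearMap.id ℂ _ - P) c₀ (FT n (toC u₁))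
  change ∀ t, HasDerivAt (fun s => M (a s)) (b t) t at hda
  change ∀ t, HasDerivAt (fun s => M (b s)) (-a t + M (M (a t) - P (M (a t)))) t at hdb
  set Q : Lp ℂ 2 (volume : Measure (Space n)) →L[ℝ] L2 n := reL.comp
    ((FT n).symm.toContinuousLinearEquiv.toContinuousLinearMap.restrictScalars ℝ) with hQ
  have hu : ∀ t, HasDerivAt (fun s => H2.toL2 (toH2 (a s))) (Q (b t)) t := fun t =>
    Q.hasFDerivAt.comp_hasDerivAt t (hda t)
  have hd : ∀ t, 0 ≤ t → timeDeriv (fun s => toH2 (a s)) t = Q (b t) := fun t ht =>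
    (hu t).hasDerivWithinAt.derivWithin (uniqueDiffOn_Ici 0 t ht)
  refine ⟨fun t => toH2 (a t), (continuous_toH2.comp ha).continuousOn, ?_, ?_, ?_, ?_⟩
  · refine (contDiff_one_iff_deriv.2 ⟨fun t => (hu t).differentiableAt, ?_⟩).contDiffOn
    rw [show deriv (fun s => H2.toL2 (toH2 (a s))) = fun t => Q (b t) from
      funext fun t => (hu t).deriv]
    exact Q.continuous.comp hb
  · rw [ha0, hc₀]
  · rw [hd 0 le_rfl, hb0]
    change reL ((FT n).symm (FT n (toC u₁))) = u₁
    rw [LinearIsometryEquiv.symm_apply_apply, reL_toC]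
  · intro φ t ht
    obtain ⟨c, -, hc1, hc2⟩ := exists_fourier_repr φ
    -- Since φ has transform M c, moving M across the pairing turns (u_t, φ) into a pairing with M
    -- b, which is differentiable while b is only known to be continuous.
    have hself : ∀ x, inner ℂ (M c) x = inner ℂ c (M x) := fun x => by
      rw [hM, inner_mulL_left, star_resolventSymbol]
    have hdb' : HasDerivAt (fun s => (inner ℂ c (M (b s))).re)
        (inner ℂ c (-a t + M (M (a t) - P (M (a t))))).re t :=
      (Complex.reCLM.comp ((innerSL ℂ c).restrictScalars ℝ)).hasFDerivAt.comp_hasDerivAt t (hdb t)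
    have h1 : inner ℝ (H2.laplacian (toH2 (a t))) (H2.laplacian φ)
        = (inner ℂ c (a t - M (M (a t)))).re := by
      rw [laplacian_toH2, inner_reL_FT, hc2, inner_mulL_left, star_laplacianSymbol, mulL_mulL,
        laplacianSymbol_mul_self, mulL_sub, mulL_one, hM, mulL_mulL]
    have h2 : ∫ x, V x * H2.toL2 (toH2 (a t)) x * H2.toL2 φ x
        = (inner ℂ c (M (P (M (a t))))).re := by
      rw [← inner_mulL_real, toL2_toH2, mulL_reL, ← (FT n).symm_apply_apply
        (mulL volume (complexify V) _), inner_reL_FT, hc1, hself, hPa]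
    convert! hdb'.congr_of_eventuallyEq ?_ using 1
    · rw [h1, h2, ← Complex.add_re, ← inner_add_right, ← Complex.neg_re, ← inner_neg_right,
        map_sub]
      congr 2
      abel
    · filter_upwards [Ioi_mem_nhds ht] with s hs
      rw [hd s (le_of_lt hs), ← hself, ← hc1]
      exact inner_reL_FT (b s) _

end Existence

end PlateEq

theorem theorem1p8 :
    ∃ C : ℝ, 0 < C ∧
      ∀ (n : ℕ), 1 ≤ n →
      ∀ (Ω : Set (PlateEq.Space n)), IsOpen Ω →
      ∀ (V : PlateEq.Space n →ᵇ ℝ), (∀ x ∈ Ω, 0 < V x) → (∀ x, 0 ≤ V x) →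
      ∀ (u₀ : PlateEq.H2 n) (u₁ : PlateEq.L2 n), PlateEq.essSupp u₁ ⊆ Ω →
        IntegrableOn (fun x => |u₁ x| ^ 2 / V x) Ω volume →
        ∃ u : ℝ → PlateEq.H2 n,
          PlateEq.IsWeakSolution V u₀ u₁ u ∧
          (∀ w : ℝ → PlateEq.H2 n, PlateEq.IsWeakSolution V u₀ u₁ w →
            ∀ t : ℝ, 0 ≤ t → w t = u t) ∧
          ∀ t : ℝ, 0 ≤ t →
            ‖PlateEq.H2.toL2 (u t)‖ ^ 2 ≤ C * (‖PlateEq.H2.toL2 u₀‖ ^ 2 + ∫ x in Ω, |u₁ x| ^ 2 / V x) := by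
  refine ⟨1, one_pos, fun n _ Ω hΩ V hpos hV u₀ u₁ hs hi => ?_⟩
  obtain ⟨u, hu⟩ := PlateEq.exists_isWeakSolution V u₀ u₁
  refine ⟨u, hu, fun w hw t ht => hw.unique hV hu ht, fun t ht => ?_⟩
  rw [one_mul]
  exact hu.norm_sq_le hΩ hpos hV hs hi ht
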